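/- For a finite connected simple graph $G=(V,E)$ with $n=|V|\ge 2$ vertices consider three continuous-time Markov chains. (RW) The random walk on $V$ which jumps along each edge at rate $1$. (IP) The interchange process: there are $n$ labelled particles, one at each vertex, and for each edge $\{u,v\}\in E$, at rate $1$, the particles at $u$ and $v$ are interchanged. (SEP) The symmetric exclusion process with $m$ particles, $1\le m\le n-1$: its state is the set of the $m$ occupied vertices, and for each edge $\{u,v\}\in E$ with $u$ occupied and $v$ vacant, the particle at $u$ moves to $v$ at rate $1$. For a chain on a finite state space $W$ with transition rate matrix $Q$, the spectral gap is the smallest $\alpha>0$ such that $Qf=-\alpha f$ for some nonzero $f:W\to\mathbb R$. Write $\lambda_{\rm RW}(G)$, $\lambda_{\rm IP}(G)$ and $\lambda_{{\rm SEP},m}(G)$ for the spectral gaps of the three chains. **Corollary.** Fix $d\ge 1$ and let $B_L=\{0,\dots,L\}^d$, with edges joining the points at $\ell^1$-distance $1$. Then, as $L\to\infty$, $$\lambda_{\rm IP}(B_L)\sim\frac{\pi^2}{L^2}\qquad\text{and}\qquad\frac{\lambda_{\rm IP}(B_L)}{\lambda_{\rm RW}(B_L)}\to 1 .$$ Moreover,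 for every choice of particle numbers $m_L$ with $1\le m_L\le (L+1)^d-1$ for all sufficiently large $L$, $$\lambda_{{\rm SEP},m_L}(B_L)\sim\frac{\pi^2}{L^2}\qquad (L\to\infty).$$ -/

import Mathlib

open scoped Topology Asymptotics

/-- The transition rate matrix of the continuous-time Markov chain that jumps from `x` to `y ≠ x`
at rate `r x y`: off the diagonal it is `r`, and its rows sum to `0` (so `r x x` is irrelevant). -/
def rateMatrix {W : Type*} [Fintype W] [DecidableEq W] (r : W → W → ℝ) : Matrix W W ℝ :=
  Matrix.of r - Matrix.diagonal (fun x => ∑ z, r x z)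

/-- The positive numbers `α` such that `Q f = -α f` for some nonzero `f : W → ℝ`. -/
def gapSet {W : Type*} [Fintype W] (Q : Matrix W W ℝ) : Set ℝ :=
  {α : ℝ | 0 < α ∧ ∃ f : W → ℝ, f ≠ 0 ∧ Q.mulVec f = (-α) • f}

/-- The spectral gap: the smallest `α > 0` such that `Q f = -α f` for some nonzero `f`. -/
noncomputable def spectralGap {W : Type*} [Fintype W] (Q : Matrix W W ℝ) : ℝ :=
  sInf (gapSet Q)

/-- The infimum in the definition of the spectral gap is a minimum. -/
theorem spectralGap_isLeast {W : Type*} [Fintype W] (Q : Matrix W W ℝ)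
    (h : (gapSet Q).Nonempty) : IsLeast (gapSet Q) (spectralGap Q) := by
  classical
  have hfin : (gapSet Q).Finite := by
    have h1 : {μ : ℝ | Module.End.HasEigenvalue (Matrix.toLin' Q) μ}.Finite :=
      Module.End.finite_hasEigenvalue (Matrix.toLin' Q)
    refine (h1.preimage (f := fun x : ℝ => -x) neg_injective.injOn).subset ?_
    rintro α ⟨-, f, hf, hQ⟩
    refine Module.End.hasEigenvalue_of_hasEigenvector (x := f) ⟨?_, hf⟩
    rw [Module.End.mem_eigenspace_iff, Matrix.toLin'_apply, hQ]
  exact ⟨h.csInf_mem hfin, fun a ha => csInf_le hfin.bddBelow ha⟩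

open Classical in
/-- Jump rates of the continuous-time random walk on `G`: rate `1` along each edge. -/
noncomputable def walkRate {V : Type*} (G : SimpleGraph V) (u v : V) : ℝ :=
  if G.Adj u v then 1 else 0

/-- Spectral gap of the continuous-time random walk on `G`. -/
noncomputable def gapRW {V : Type*} [Fintype V] [DecidableEq V] (G : SimpleGraph V) : ℝ :=
  spectralGap (rateMatrix (walkRate G))

/-- A configuration of the interchange process: one of the `n = |V|` labelled particles at each
vertex; `η i` is the vertex that holds particle `i`. -/
abbrev Configuration (V : Type*) [Fintype V] : Type _ := Fin (Fintype.card V) ≃ V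

open Classical in
/-- Jump rates of the interchange process: for each edge `{u, v}`, at rate `1`, the particles at
`u` and `v` are interchanged (distinct edges lead from `η` to distinct configurations). -/
noncomputable def interchangeRate {V : Type*} [Fintype V] [DecidableEq V] (G : SimpleGraph V)
    (η ξ : Configuration V) : ℝ :=
  if ∃ u v : V, G.Adj u v ∧ ξ = η.trans (Equiv.swap u v) then 1 else 0

/-- Spectral gap of the interchange process on `G`. -/
noncomputable def gapIP {V : Type*} [Fintype V] [DecidableEq V] (G : SimpleGraph V) : ℝ :=
  spectralGap (rateMatrix (interchangeRate G))

open Classical in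
/-- Jump rates of the symmetric exclusion process with `m` particles; a state is the set of occupied
vertices. For each edge `{u, v}` with `u` occupied and `v` vacant, the particle at `u` jumps to `v`
at rate `1` (distinct such edges lead from `s` to distinct states). -/
noncomputable def exclusionRate {V : Type*} [DecidableEq V] (G : SimpleGraph V) (m : ℕ)
    (s t : {s : Finset V // s.card = m}) : ℝ :=
  if ∃ u v : V, G.Adj u v ∧ u ∈ s.1 ∧ v ∉ s.1 ∧ t.1 = insert v (s.1.erase u) then 1 else 0

/-- Spectral gap of the symmetric exclusion process with `m` particles on `G`. -/
noncomputable def gapSEP {V : Type*} [Fintype V] [DecidableEq V] (G : SimpleGraph V) (m : ℕ) : ℝ :=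
  spectralGap (rateMatrix (exclusionRate G m))

/-- The box `{0, …, L}^d`, as an induced subgraph of the nearest-neighbour lattice `ℤ^d`:
vertices are adjacent when their `ℓ¹` distance is `1`. -/
def boxGraph (d L : ℕ) : SimpleGraph (Fin d → Fin (L + 1)) where
  Adj x y := ∑ i, |((x i : ℕ) : ℤ) - ((y i : ℕ) : ℤ)| = 1
  symm := ⟨fun x y h => by simpa only [abs_sub_comm] using h⟩
  loopless := ⟨fun x h => by simp at h⟩

/-! For every L ≥ 1 the three gaps coincide exactly: each equals `pathGap L` = 2 - 2 cos(π/(L+1)) =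
4 sin²(π/(2(L+1))), which is asymptotic to π²/L². The dimension and the number of particles play no
role.

For the random walk this is a Poincaré constant. On a path it comes from a ground-state comparison
for the partial sums (`dirichlet_poincare`, `path_poincare`). It passes to products by splitting the
variance (`poincareBound_prod`), and the cosine of one coordinate attains it (`boxMode_eigen`). The
same cosine, evaluated at one particle or summed over the occupied set, is an eigenfunction of the
interchange or exclusion process, so those gaps are at most `pathGap L`.

The reverse inequality is Aldous' spectral gap conjecture, the theorem of Caputo, Liggett and
Richthammer (`dirichlet_bound_of_walk`), proved by induction on the number of vertices. An
eigenfunction on the group whose eigenvalue lies below the walk bound has vanishing sums over the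
cosets of a vertex stabilizer, because those sums would be walk eigenfunctions with the same
eigenvalue. Delete a vertex and replace its star of rates w by the extra rates w_y w_z / ∑ w. The
walk bound survives (`walk_bound_reduced`), so induction bounds the reduced Dirichlet form on those
cosets. The octopus inequality (`octopus_inequality`) says that the reduced form is at most the
original one, a contradiction.

The octopus inequality is equivalent to ⟨f, Xf⟩ ≥ 0 for X = ∑ c_i c_j (i j), where c is w on the
outer vertices and -∑ w at the hub. Since ∑ c = 0, the form of 2|c|² X - X² is a combination of
defects ‖f‖² - ⟨f, gf⟩ of 3-cycles and double transpositions (`correlation_identity`). It is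
nonnegative by two local inequalities, on four and on five points, which come from multiples of
projections in the group rings of A₄ and A₅. Hence 2|c|² ⟨f, Xf⟩ ≥ ‖Xf‖² ≥ 0. -/

/-! ### Autocorrelations of a function on a set with a group action -/

section Autocorrelation

variable {H Ω : Type*} [Group H] [Fintype Ω]

/-- The correlation `∑ ω, f ω * f (σ ω)` of a function with its translate by a permutation. -/
def autocorr (f : Ω → ℝ) (σ : Equiv.Perm Ω) : ℝ := ∑ ω, f ω * f (σ ω)

theorem autocorr_mul_inv (f : Ω → ℝ) (σ τ : Equiv.Perm Ω) :
    autocorr f (σ * τ⁻¹) = ∑ ω, f (τ ω) * f (σ ω) := by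
  unfold autocorr
  rw [← Equiv.sum_comp τ]
  simp

theorem autocorr_inv (f : Ω → ℝ) (σ : Equiv.Perm Ω) : autocorr f σ⁻¹ = autocorr f σ := by
  have := autocorr_mul_inv f 1 σ
  rw [one_mul] at this
  rw [this]
  simp [autocorr, mul_comm]

theorem list_sum_map_finset_sum {α κ : Type*} [Fintype κ] (L : List α) (F : α → κ → ℝ) :
    (L.map fun p => ∑ k, F p k).sum = ∑ k, (L.map fun p => F p k).sum := by
  induction L with
  | nil => simp
  | cons p L ih => simp [ih, Finset.sum_add_distrib]

/-- If an element `∑ z g` of the integral group ring satisfies `N * N^* = C * N` with `C > 0`, then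
it gives a nonnegative quadratic form in every permutation representation. -/
theorem groupRing_form_nonneg [Fintype H] [DecidableEq H] (ψ : H →* Equiv.Perm Ω) (f : Ω → ℝ)
    (L : List (ℤ × H)) (κ : H → ℤ) (C : ℤ) (hC : 0 < C)
    (hκ : ∀ k, κ k = (L.map fun p => if p.2 = k then p.1 else 0).sum)
    (hconv : ∀ k, (L.map fun q => q.1 * κ (k * q.2)).sum = C * κ k) :
    0 ≤ (L.map fun p => (p.1 : ℝ) * autocorr f (ψ p.2)).sum := by
  have expand : ∀ F : H → ℝ, (L.map fun p => (p.1 : ℝ) * F p.2).sum = ∑ k, (κ k : ℝ) * F k := by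
    intro F
    have : ∀ k, (κ k : ℝ) * F k = (L.map fun p => if p.2 = k then (p.1 : ℝ) * F k else 0).sum := by
      intro k
      rw [hκ k, Int.cast_list_sum, List.map_map, ← List.sum_map_mul_right]
      congr 1
      refine List.map_congr_left fun p _ => ?_
      simp only [Function.comp]
      split_ifs <;> simp
    rw [Finset.sum_congr rfl fun k _ => this k, ← list_sum_map_finset_sum]
    simp
  -- The form of N N^* is computed twice: expanded it is a sum of squares, and in `hlin` it is C
  -- times the form of N. The coefficient of k in N N^* is the convolution in `hconv`.
  have hsq : (L.map fun q => (q.1 : ℝ) *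
      (L.map fun p => (p.1 : ℝ) * autocorr f (ψ (p.2 * q.2⁻¹))).sum).sum
      = ∑ ω, ((L.map fun p => (p.1 : ℝ) * f (ψ p.2 ω)).sum) ^ 2 := by
    simp_rw [pow_two, ← List.sum_map_mul_right]
    rw [← list_sum_map_finset_sum]
    congr 1
    refine List.map_congr_left fun q _ => ?_
    simp_rw [map_mul, map_inv, autocorr_mul_inv, ← List.sum_map_mul_left, Finset.mul_sum]
    rw [list_sum_map_finset_sum]
    refine Finset.sum_congr rfl fun ω _ => ?_
    congr 1
    refine List.map_congr_left fun p _ => ?_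
    ring
  have hlin : (L.map fun q => (q.1 : ℝ) *
      (L.map fun p => (p.1 : ℝ) * autocorr f (ψ (p.2 * q.2⁻¹))).sum).sum
      = C * (L.map fun p => (p.1 : ℝ) * autocorr f (ψ p.2)).sum := by
    have h1 : ∀ q : ℤ × H, (q.1 : ℝ) *
        (L.map fun p => (p.1 : ℝ) * autocorr f (ψ (p.2 * q.2⁻¹))).sum
        = ∑ k, (q.1 : ℝ) * (κ (k * q.2) : ℝ) * autocorr f (ψ k) := by
      intro q
      rw [expand fun g => autocorr f (ψ (g * q.2⁻¹)), ← Equiv.sum_comp (Equiv.mulRight q.2),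
        Finset.mul_sum]
      refine Finset.sum_congr rfl fun k _ => ?_
      simp [mul_assoc]
    rw [List.map_congr_left fun q _ => h1 q, list_sum_map_finset_sum,
      expand fun g => autocorr f (ψ g), Finset.mul_sum]
    refine Finset.sum_congr rfl fun k _ => ?_
    rw [List.sum_map_mul_right, ← mul_assoc]
    congr 1
    have := hconv k
    have h2 := congrArg (Int.cast : ℤ → ℝ) this
    rw [Int.cast_list_sum, List.map_map] at h2
    push_cast at h2
    rw [← h2]
    congr 1
    refine List.map_congr_left fun p _ => ?_
    simp
  have h0 : (0 : ℝ) ≤ C * (L.map fun p => (p.1 : ℝ) * autocorr f (ψ p.2)).sum := by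
    rw [← hlin, hsq]
    positivity
  have hC' : (0 : ℝ) < C := by exact_mod_cast hC
  exact nonneg_of_mul_nonneg_right h0 hC'

theorem viaEmbeddingHom_swap {α β : Type*} [DecidableEq α] [DecidableEq β] (e : α ↪ β) (x y : α) :
    Equiv.Perm.viaEmbeddingHom e (Equiv.swap x y) = Equiv.swap (e x) (e y) := by
  ext b
  rw [Equiv.Perm.viaEmbeddingHom_apply]
  by_cases hb : b ∈ Set.range e
  · obtain ⟨a, rfl⟩ := hb
    rw [Equiv.Perm.viaEmbedding_apply]
    exact (e.injective.swap_apply x y a).symm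
  · rw [Equiv.Perm.viaEmbedding_apply_of_notMem _ _ _ hb, Equiv.swap_apply_of_ne_of_ne]
    · rintro rfl; exact hb ⟨x, rfl⟩
    · rintro rfl; exact hb ⟨y, rfl⟩

end Autocorrelation

/-! ### Two positive elements of the group rings of the alternating groups -/

section Kernels

open Equiv

/-- `2 - ∑ (3-cycles) + 2 ∑ (double transpositions)` in the group ring of `A₄`. -/
def kernelFourList : List (ℤ × Perm (Fin 4)) :=
  [(2, 1),
    (-1, swap 0 1 * swap 1 2), (-1, swap 1 2 * swap 0 1),
    (-1, swap 0 1 * swap 1 3), (-1, swap 1 3 * swap 0 1),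
    (-1, swap 0 2 * swap 2 3), (-1, swap 2 3 * swap 0 2),
    (-1, swap 1 2 * swap 2 3), (-1, swap 2 3 * swap 1 2),
    (2, swap 0 1 * swap 2 3), (2, swap 0 2 * swap 1 3), (2, swap 0 3 * swap 1 2)]

/-- The coefficients of `kernelFourList`. -/
def kernelFour (g : Perm (Fin 4)) : ℤ :=
  (kernelFourList.map fun p => if p.2 = g then p.1 else 0).sum

/-- The element is twelve times the central idempotent of A₄ for its two nontrivial linear
characters, whose sum takes the values 2, -1, 2 on the identity, the 3-cycles and the double
transpositions. -/
theorem kernelFour_conv :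
    ∀ k, (kernelFourList.map fun q => q.1 * kernelFour (k * q.2)).sum = 12 * kernelFour k := by
  decide +kernel

/-- `3 - ∑ (3-cycles moving 0) + ∑ (double transpositions moving 0)
- ∑ (double transpositions fixing 0)` in the group ring of `A₅`. -/
def kernelFiveList : List (ℤ × Perm (Fin 5)) :=
  [(3, 1),
    (-1, swap 0 1 * swap 1 2), (-1, swap 1 2 * swap 0 1),
    (-1, swap 0 1 * swap 1 3), (-1, swap 1 3 * swap 0 1),
    (-1, swap 0 1 * swap 1 4), (-1, swap 1 4 * swap 0 1),
    (-1, swap 0 2 * swap 2 3), (-1, swap 2 3 * swap 0 2),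
    (-1, swap 0 2 * swap 2 4), (-1, swap 2 4 * swap 0 2),
    (-1, swap 0 3 * swap 3 4), (-1, swap 3 4 * swap 0 3),
    (1, swap 0 1 * swap 2 3), (1, swap 0 1 * swap 2 4), (1, swap 0 1 * swap 3 4),
    (1, swap 0 2 * swap 1 3), (1, swap 0 2 * swap 1 4), (1, swap 0 2 * swap 3 4),
    (1, swap 0 3 * swap 1 2), (1, swap 0 3 * swap 1 4), (1, swap 0 3 * swap 2 4),
    (1, swap 0 4 * swap 1 2), (1, swap 0 4 * swap 1 3), (1, swap 0 4 * swap 2 3),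
    (-1, swap 1 2 * swap 3 4), (-1, swap 1 3 * swap 2 4), (-1, swap 1 4 * swap 2 3)]

/-- The permutations in `kernelFiveList`, by their values. -/
def kernelFiveTable : List (ℤ × ℕ × ℕ × ℕ × ℕ × ℕ) :=
  [(3, 0, 1, 2, 3, 4), (-1, 1, 2, 0, 3, 4), (-1, 2, 0, 1, 3, 4), (-1, 1, 3, 2, 0, 4),
    (-1, 3, 0, 2, 1, 4), (-1, 1, 4, 2, 3, 0), (-1, 4, 0, 2, 3, 1), (-1, 2, 1, 3, 0, 4),
    (-1, 3, 1, 0, 2, 4), (-1, 2, 1, 4, 3, 0), (-1, 4, 1, 0, 3, 2), (-1, 3, 1, 2, 4, 0),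
    (-1, 4, 1, 2, 0, 3), (1, 1, 0, 3, 2, 4), (1, 1, 0, 4, 3, 2), (1, 1, 0, 2, 4, 3),
    (1, 2, 3, 0, 1, 4), (1, 2, 4, 0, 3, 1), (1, 2, 1, 0, 4, 3), (1, 3, 2, 1, 0, 4),
    (1, 3, 4, 2, 0, 1), (1, 3, 1, 4, 0, 2), (1, 4, 2, 1, 3, 0), (1, 4, 3, 2, 1, 0),
    (1, 4, 1, 3, 2, 0), (-1, 0, 2, 1, 4, 3), (-1, 0, 3, 4, 1, 2), (-1, 0, 4, 3, 2, 1)]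

/-- The coefficient in `kernelFiveList` of the permutation with the given values. -/
def kernelFiveValue (a b c d e : ℕ) : ℤ :=
  -- The number of fixed points nearly determines the type: 5 for the identity, 2 for a 3-cycle, 1
  -- for a double transposition or a 4-cycle. The last two are told apart by the presence of a
  -- 2-cycle.
  match (if a = 0 then 1 else 0) + (if b = 1 then 1 else 0) + (if c = 2 then 1 else 0) +
    (if d = 3 then 1 else 0) + (if e = 4 then 1 else 0) with
  | 5 => 3
  | 2 => if a = 0 then 0 else -1
  | 1 => if a = 0 ∧ (b = 2 ∧ c = 1 ∨ b = 3 ∧ d = 1 ∨ b = 4 ∧ e = 1) then -1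
      else if (a = 1 ∧ b = 0 ∨ a = 2 ∧ c = 0 ∨ a = 3 ∧ d = 0 ∨ a = 4 ∧ e = 0) ∧
        (b = 2 ∧ c = 1 ∨ b = 3 ∧ d = 1 ∨ b = 4 ∧ e = 1 ∨ c = 3 ∧ d = 2 ∨ c = 4 ∧ e = 2 ∨
          d = 4 ∧ e = 3) then 1
      else 0
  | _ => 0

/-- The coefficients of `kernelFiveList`. -/
def kernelFive (g : Perm (Fin 5)) : ℤ :=
  kernelFiveValue (g 0) (g 1) (g 2) (g 3) (g 4)

/-- The entry with index `x` of a five-tuple. -/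
def tupleEntry (a b c d e x : ℕ) : ℕ :=
  match x with
  | 0 => a | 1 => b | 2 => c | 3 => d | _ => e

theorem kernelFiveTable_eq : kernelFiveTable = kernelFiveList.map fun p =>
    (p.1, ((p.2 0 : Fin 5) : ℕ), ((p.2 1 : Fin 5) : ℕ), ((p.2 2 : Fin 5) : ℕ),
      ((p.2 3 : Fin 5) : ℕ), ((p.2 4 : Fin 5) : ℕ)) := by
  decide +kernel

theorem kernelFiveValue_conv : ∀ a b c d e : Fin 5, [a, b, c, d, e].Nodup →
    (kernelFiveTable.map fun p => p.1 * kernelFiveValue (tupleEntry a b c d e p.2.1)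
      (tupleEntry a b c d e p.2.2.1) (tupleEntry a b c d e p.2.2.2.1)
      (tupleEntry a b c d e p.2.2.2.2.1) (tupleEntry a b c d e p.2.2.2.2.2)).sum
      = 12 * kernelFiveValue a b c d e := by
  decide +kernel

theorem kernelFiveValue_eq : ∀ a b c d e : Fin 5, [a, b, c, d, e].Nodup →
    kernelFiveValue a b c d e = (kernelFiveTable.map fun p =>
      if p.2 = ((a : ℕ), (b : ℕ), (c : ℕ), (d : ℕ), (e : ℕ)) then p.1 else 0).sum := by
  decide +kernel

theorem nodup_perm_values (g : Perm (Fin 5)) : [g 0, g 1, g 2, g 3, g 4].Nodup := by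
  simp [EmbeddingLike.apply_eq_iff_eq]

theorem tupleEntry_perm (k : Perm (Fin 5)) (x : Fin 5) :
    tupleEntry (k 0) (k 1) (k 2) (k 3) (k 4) (x : ℕ) = ((k x : Fin 5) : ℕ) := by
  fin_cases x <;> rfl

theorem kernelFive_eq (k : Perm (Fin 5)) :
    kernelFive k = (kernelFiveList.map fun p => if p.2 = k then p.1 else 0).sum := by
  rw [kernelFive, kernelFiveValue_eq _ _ _ _ _ (nodup_perm_values k), kernelFiveTable_eq,
    List.map_map]
  congr 1
  refine List.map_congr_left fun p _ => ?_
  have : p.2 = k ↔ (p.2 0 = k 0 ∧ p.2 1 = k 1 ∧ p.2 2 = k 2 ∧ p.2 3 = k 3 ∧ p.2 4 = k 4) := by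
    constructor
    · rintro rfl; simp
    · rintro ⟨h0, h1, h2, h3, h4⟩
      ext x
      fin_cases x <;> simp [*]
  simp only [Function.comp, this, Prod.mk.injEq, Fin.val_inj]

/-- The element commutes with the stabilizer A₄ of 0. It is twelve times a projection: in the
five-dimensional irreducible representation of A₅ onto the three-dimensional constituent for that
A₄, and zero in the other irreducible representations. -/
theorem kernelFive_conv (k : Perm (Fin 5)) :
    (kernelFiveList.map fun q => q.1 * kernelFive (k * q.2)).sum = 12 * kernelFive k := by
  have := kernelFiveValue_conv _ _ _ _ _ (nodup_perm_values k)
  rw [kernelFiveTable_eq, List.map_map] at this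
  simpa only [Function.comp_def, tupleEntry_perm, kernelFive, Perm.mul_apply] using this

end Kernels

/-! ### The octopus inequality -/

section Octopus

open Equiv

variable {V Ω : Type*} [Fintype Ω]

section Defects

variable [DecidableEq V] (ψ : Perm V →* Perm Ω) (f : Ω → ℝ)

/-- The defect `‖f‖² - ⟨f, g f⟩` of a transposition `g`. -/
def swapDefect (i j : V) : ℝ := autocorr f 1 - autocorr f (ψ (swap i j))

/-- The defect `‖f‖² - ⟨f, g f⟩` of `g = (i j)(j k)`. -/
def cycleDefect (i j k : V) : ℝ := autocorr f 1 - autocorr f (ψ (swap i j * swap j k))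

/-- The defect `‖f‖² - ⟨f, g f⟩` of `g = (i j)(k l)`. -/
def pairDefect (i j k l : V) : ℝ := autocorr f 1 - autocorr f (ψ (swap i j * swap k l))

theorem autocorr_swap_mul_swap_comm (i j k l : V) :
    autocorr f (ψ (swap i j * swap k l)) = autocorr f (ψ (swap k l * swap i j)) := by
  rw [← autocorr_inv, ← map_inv, mul_inv_rev, swap_inv, swap_inv]

/-- The coefficients of `kernelFourList` sum to zero, so correlations may be replaced by minus
defects. A 3-cycle and its inverse have equal defect, and a common factor 2 drops out. -/
theorem four_point_nonneg (i j k l : V) (h : [i, j, k, l].Nodup) :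
    0 ≤ cycleDefect ψ f i j k + cycleDefect ψ f i j l + cycleDefect ψ f i k l
      + cycleDefect ψ f j k l
      - pairDefect ψ f i j k l - pairDefect ψ f i k j l - pairDefect ψ f i l j k := by
  let e : Fin 4 ↪ V := ⟨![i, j, k, l], by
    simp only [List.nodup_cons, List.mem_cons, List.not_mem_nil, or_false, not_or] at h
    intro x y hxy
    fin_cases x <;> fin_cases y <;> simp_all⟩
  have e0 : e 0 = i := rfl
  have e1 : e 1 = j := rfl
  have e2 : e 2 = k := rfl
  have e3 : e 3 = l := rfl
  have := groupRing_form_nonneg (ψ.comp (Perm.viaEmbeddingHom e)) f kernelFourList kernelFour 12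
    (by norm_num) (fun k => rfl) kernelFour_conv
  simp only [kernelFourList, List.map_cons, List.map_nil, List.sum_cons, List.sum_nil,
    MonoidHom.comp_apply, map_mul, viaEmbeddingHom_swap, e0, e1, e2, e3, map_one] at this
  simp only [← map_mul] at this
  rw [autocorr_swap_mul_swap_comm ψ f j k i j, autocorr_swap_mul_swap_comm ψ f j l i j,
    autocorr_swap_mul_swap_comm ψ f k l i k, autocorr_swap_mul_swap_comm ψ f k l j k] at this
  unfold cycleDefect pairDefect
  push_cast at this
  linarith

/-- The same translation for `kernelFiveList`, whose coefficients also sum to zero; `o`, the point 0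
of the kernel, will be the hub of the octopus. -/
theorem five_point_nonneg (o i j k l : V) (h : [o, i, j, k, l].Nodup) :
    0 ≤ 2 * (cycleDefect ψ f o i j + cycleDefect ψ f o i k + cycleDefect ψ f o i l
        + cycleDefect ψ f o j k + cycleDefect ψ f o j l + cycleDefect ψ f o k l)
      + (pairDefect ψ f i j k l + pairDefect ψ f i k j l + pairDefect ψ f i l j k)
      - (pairDefect ψ f o i j k + pairDefect ψ f o i j l + pairDefect ψ f o i k l
        + pairDefect ψ f o j i k + pairDefect ψ f o j i l + pairDefect ψ f o j k l
        + pairDefect ψ f o k i j + pairDefect ψ f o k i l + pairDefect ψ f o k j l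
        + pairDefect ψ f o l i j + pairDefect ψ f o l i k + pairDefect ψ f o l j k) := by
  let e : Fin 5 ↪ V := ⟨![o, i, j, k, l], by
    simp only [List.nodup_cons, List.mem_cons, List.not_mem_nil, or_false, not_or] at h
    intro x y hxy
    fin_cases x <;> fin_cases y <;> simp_all⟩
  have e0 : e 0 = o := rfl
  have e1 : e 1 = i := rfl
  have e2 : e 2 = j := rfl
  have e3 : e 3 = k := rfl
  have e4 : e 4 = l := rfl
  have := groupRing_form_nonneg (ψ.comp (Perm.viaEmbeddingHom e)) f kernelFiveList kernelFive 12
    (by norm_num) kernelFive_eq kernelFive_conv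
  simp only [kernelFiveList, List.map_cons, List.map_nil, List.sum_cons, List.sum_nil,
    MonoidHom.comp_apply, map_mul, viaEmbeddingHom_swap, e0, e1, e2, e3, e4, map_one] at this
  simp only [← map_mul] at this
  rw [autocorr_swap_mul_swap_comm ψ f i j o i, autocorr_swap_mul_swap_comm ψ f i k o i,
    autocorr_swap_mul_swap_comm ψ f i l o i, autocorr_swap_mul_swap_comm ψ f j k o j,
    autocorr_swap_mul_swap_comm ψ f j l o j, autocorr_swap_mul_swap_comm ψ f k l o k] at this
  unfold cycleDefect pairDefect
  push_cast at this
  linarith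

end Defects

end Octopus

/-! ### Positivity of quartic forms in the weights -/

section QuarticForms

open Finset

variable {W : Type*} [Fintype W]

theorem sum_three_swap_last (F : W → W → W → ℝ) :
    ∑ i, ∑ j, ∑ k, F i j k = ∑ i, ∑ j, ∑ k, F i k j :=
  sum_congr rfl fun _ _ => sum_comm

theorem sum_three_swap_first (F : W → W → W → ℝ) :
    ∑ i, ∑ j, ∑ k, F i j k = ∑ i, ∑ j, ∑ k, F j i k :=
  sum_comm

theorem sum_four_rotate (F : W → W → W → W → ℝ) :
    ∑ i, ∑ j, ∑ k, ∑ l, F i j k l = ∑ i, ∑ j, ∑ k, ∑ l, F j k i l := by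
  rw [sum_three_swap_last, sum_three_swap_first]

theorem sum_four_flip (F : W → W → W → W → ℝ) :
    ∑ i, ∑ j, ∑ k, ∑ l, F i j k l = ∑ i, ∑ j, ∑ k, ∑ l, F j i l k := by
  rw [sum_three_swap_first]
  exact sum_congr rfl fun i _ => sum_three_swap_last _

theorem sum_four_exchange (F : W → W → W → W → ℝ) :
    ∑ i, ∑ j, ∑ k, ∑ l, F i j k l = ∑ i, ∑ j, ∑ k, ∑ l, F k l i j := by
  calc ∑ i, ∑ j, ∑ k, ∑ l, F i j k l
      = ∑ i, ∑ j, ∑ k, ∑ l, F i k j l := sum_three_swap_last _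
    _ = ∑ i, ∑ j, ∑ k, ∑ l, F j k i l := sum_three_swap_first _
    _ = ∑ i, ∑ j, ∑ k, ∑ l, F j l i k := sum_congr rfl fun i _ => sum_three_swap_last _
    _ = ∑ i, ∑ j, ∑ k, ∑ l, F k l i j := sum_three_swap_last _

/-- A fourfold sum as an average over the alternating group of its indices. -/
theorem sum_four_even_average (g : W → W → W → W → ℝ) :
    12 * ∑ i, ∑ j, ∑ k, ∑ l, g i j k l = ∑ i, ∑ j, ∑ k, ∑ l,
      (g i j k l + g j k i l + g k i j l + g j i l k + g i l j k + g l j i k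
        + g k l i j + g l i k j + g i k l j + g l k j i + g k j l i + g j l k i) := by
  let P : (W → W → W → W → ℝ) → ℝ := fun F => ∑ i, ∑ j, ∑ k, ∑ l, F i j k l
  -- Three rotations of the first three indices, followed by the Klein four-group generated by the
  -- flip and the exchange, run through A₄.
  let g1 : W → W → W → W → ℝ := fun i j k l => g i j k l + g j k i l + g k i j l
  have hg1 : P g1 = 3 * P g := by
    have r1 : P g = P fun i j k l => g j k i l := sum_four_rotate g
    have r2 : P (fun i j k l => g j k i l) = P fun i j k l => g k i j l :=
      sum_four_rotate fun i j k l => g j k i l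
    have : P g1 = P g + P (fun i j k l => g j k i l) + P fun i j k l => g k i j l := by
      simp only [P, g1, sum_add_distrib]
    linarith
  have r1 : P g1 = P fun i j k l => g1 j i l k := sum_four_flip g1
  have r2 : P g1 = P fun i j k l => g1 k l i j := sum_four_exchange g1
  have r3 : P (fun i j k l => g1 k l i j) = P fun i j k l => g1 l k j i :=
    sum_four_flip fun i j k l => g1 k l i j
  have : (∑ i, ∑ j, ∑ k, ∑ l,
      (g i j k l + g j k i l + g k i j l + g j i l k + g i l j k + g l j i k
        + g k l i j + g l i k j + g i k l j + g l k j i + g k j l i + g j l k i))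
      = P g1 + P (fun i j k l => g1 j i l k) + P (fun i j k l => g1 k l i j)
        + P fun i j k l => g1 l k j i := by
    simp only [P, g1, sum_add_distrib]
    ring
  rw [this]
  change 12 * P g = _
  linarith

variable [DecidableEq W]

/-- Positivity of a quartic form in nonnegative weights from its symmetrized coefficients. -/
theorem quartic_form_nonneg (w : W → ℝ) (hw : ∀ i, 0 ≤ w i)
    (x : W → W → W → ℝ) (x0 : W → W → ℝ) (y : W → W → W → W → ℝ) (y0 : W → W → W → ℝ)
    (hx : ∀ i j k, (i = j ∨ i = k ∨ j = k) → x i j k = 0)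
    (hx0 : ∀ i, x0 i i = 0) (hx0s : ∀ i j, x0 i j = x0 j i)
    (hy : ∀ i j k l, ¬ [i, j, k, l].Nodup → y i j k l = 0)
    (hys : ∀ i j k l, y i j k l = y j i k l ∧ y i j k l = y i j l k ∧ y i j k l = y k l i j)
    (hy0 : ∀ i j k, (i = j ∨ i = k ∨ j = k) → y0 i j k = 0)
    (hy0s : ∀ i j k, y0 i j k = y0 i k j)
    (h3 : ∀ i j k, i ≠ j → i ≠ k → j ≠ k →
      0 ≤ x0 i j + x0 i k + x0 j k + x i j k - y0 i j k - y0 j i k - y0 k i j)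
    (h4 : ∀ i j k l, [i, j, k, l].Nodup →
      0 ≤ 2 * (x0 i j + x0 i k + x0 i l + x0 j k + x0 j l + x0 k l)
        + (y i j k l + y i k j l + y i l j k)
        - (y0 i j k + y0 i j l + y0 i k l + y0 j i k + y0 j i l + y0 j k l
          + y0 k i j + y0 k i l + y0 k j l + y0 l i j + y0 l i k + y0 l j k)) :
    0 ≤ 4 * (∑ i, ∑ j, ∑ k, w i ^ 2 * w j * w k * x i j k
          + (∑ i, w i) ^ 2 * ∑ i, ∑ j, w i * w j * x0 i j
          - 2 * (∑ i, w i) * ∑ i, ∑ j, w i ^ 2 * w j * x0 i j)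
      + ∑ i, ∑ j, ∑ k, ∑ l, w i * w j * w k * w l * y i j k l
      - 4 * (∑ i, w i) * ∑ i, ∑ j, ∑ k, w i * w j * w k * y0 i j k := by
  set s := ∑ i, w i with hs
  -- Here x and y stand for the defects of 3-cycles and double transpositions among outer points, x0
  -- and y0 for those that also move the hub. The factors s = ∑ w are expanded until only sums over
  -- distinct indices remain: triples with one weight squared, and quadruples.
  let z : W → W → W → ℝ := fun i j k => if i ≠ j ∧ i ≠ k then x0 j k else 0
  let h : W → W → W → ℝ := fun i j k => z i j k - y0 i j k
  let h' : W → W → W → W → ℝ := fun i j k l => if l ≠ i ∧ l ≠ j ∧ l ≠ k then h i j k else 0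
  have hz : ∀ i j k, (i = j ∨ i = k ∨ j = k) → z i j k = 0 := by
    rintro i j k (rfl | rfl | rfl) <;> simp [z, hx0]
  have hh : ∀ i j k, (i = j ∨ i = k ∨ j = k) → h i j k = 0 := by
    intro i j k hc
    simp [h, hz i j k hc, hy0 i j k hc]
  -- The terms in which the new index meets an old one are exactly what the -2s term of the form
  -- cancels.
  have e1 : s * ∑ i, ∑ j, w i * w j * x0 i j
      = ∑ i, ∑ j, ∑ k, w i * w j * w k * z i j k
        + 2 * ∑ i, ∑ j, w i ^ 2 * w j * x0 i j := by
    have p : ∀ i j k, x0 j k = z i j k + (if i = j then x0 j k else 0)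
        + (if i = k then x0 j k else 0) := by
      intro i j k
      by_cases h1 : i = j
      · by_cases h2 : i = k
        · subst h1; subst h2; simp [z, hx0]
        · simp [z, h1]; intro h3; rw [← h3, hx0]
      · by_cases h2 : i = k
        · subst h2; simp [z, h1]
        · simp [z, h1, h2]
    have q1 : ∑ i, ∑ j, ∑ k, w i * w j * w k * (if i = j then x0 j k else 0)
        = ∑ i, ∑ j, w i ^ 2 * w j * x0 i j := by
      refine sum_congr rfl fun i _ => ?_
      rw [sum_comm]
      refine sum_congr rfl fun k _ => ?_
      simp only [mul_ite, mul_zero, sum_ite_eq, mem_univ, if_true]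
      ring
    have q2 : ∑ i, ∑ j, ∑ k, w i * w j * w k * (if i = k then x0 j k else 0)
        = ∑ i, ∑ j, w i ^ 2 * w j * x0 i j := by
      refine sum_congr rfl fun i _ => sum_congr rfl fun k _ => ?_
      simp only [mul_ite, mul_zero, sum_ite_eq, mem_univ, if_true]
      rw [hx0s]
      ring
    calc s * ∑ i, ∑ j, w i * w j * x0 i j
        = ∑ i, ∑ j, ∑ k, w i * w j * w k * x0 j k := by
          rw [hs, sum_mul]
          simp only [mul_sum, mul_assoc]
      _ = ∑ i, ∑ j, ∑ k, (w i * w j * w k * z i j k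
            + w i * w j * w k * (if i = j then x0 j k else 0)
            + w i * w j * w k * (if i = k then x0 j k else 0)) := by
          refine sum_congr rfl fun i _ => sum_congr rfl fun j _ => sum_congr rfl fun k _ => ?_
          rw [← mul_add, ← mul_add, ← p]
      _ = _ := by
          simp only [sum_add_distrib]
          rw [q1, q2]
          ring
  -- The second factor s either adds a fourth distinct index or doubles one of the three. The
  -- doubled terms feed `key3`, the others `key4`.
  have e2 : s * ∑ i, ∑ j, ∑ k, w i * w j * w k * h i j k
      = ∑ i, ∑ j, ∑ k, ∑ l, w i * w j * w k * w l * h' i j k l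
        + ∑ i, ∑ j, ∑ k, w i ^ 2 * w j * w k * (h i j k + h j i k + h k j i) := by
    have p : ∀ i j k l, h i j k = h' i j k l + (if l = i then h i j k else 0)
        + (if l = j then h i j k else 0) + (if l = k then h i j k else 0) := by
      intro i j k l
      by_cases hc : i = j ∨ i = k ∨ j = k
      · simp [h', hh i j k hc]
      · push Not at hc
        obtain ⟨c1, c2, c3⟩ := hc
        by_cases h1 : l = i
        · subst h1; simp [h', c1, c2]
        · by_cases h2 : l = j
          · subst h2; simp [h', c3, h1]
          · by_cases h3 : l = k
            · subst h3; simp [h', h1, h2]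
            · simp [h', h1, h2, h3]
    have q1 : ∑ i, ∑ j, ∑ k, ∑ l, w i * w j * w k * w l * (if l = i then h i j k else 0)
        = ∑ i, ∑ j, ∑ k, w i ^ 2 * w j * w k * h i j k := by
      refine sum_congr rfl fun i _ => sum_congr rfl fun j _ => sum_congr rfl fun k _ => ?_
      simp only [mul_ite, mul_zero, sum_ite_eq', mem_univ, if_true]
      ring
    have q2 : ∑ i, ∑ j, ∑ k, ∑ l, w i * w j * w k * w l * (if l = j then h i j k else 0)
        = ∑ i, ∑ j, ∑ k, w i ^ 2 * w j * w k * h j i k := by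
      rw [sum_three_swap_first]
      refine sum_congr rfl fun i _ => sum_congr rfl fun j _ => sum_congr rfl fun k _ => ?_
      simp only [mul_ite, mul_zero, sum_ite_eq', mem_univ, if_true]
      ring
    have q3 : ∑ i, ∑ j, ∑ k, ∑ l, w i * w j * w k * w l * (if l = k then h i j k else 0)
        = ∑ i, ∑ j, ∑ k, w i ^ 2 * w j * w k * h k j i := by
      rw [sum_three_swap_last, sum_three_swap_first, sum_three_swap_last]
      refine sum_congr rfl fun i _ => sum_congr rfl fun j _ => sum_congr rfl fun k _ => ?_
      simp only [mul_ite, mul_zero, sum_ite_eq', mem_univ, if_true]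
      ring
    calc s * ∑ i, ∑ j, ∑ k, w i * w j * w k * h i j k
        = ∑ i, ∑ j, ∑ k, ∑ l, w i * w j * w k * w l * h i j k := by
          rw [mul_comm, sum_mul]
          refine sum_congr rfl fun i _ => ?_
          rw [sum_mul]
          refine sum_congr rfl fun j _ => ?_
          rw [sum_mul]
          refine sum_congr rfl fun k _ => ?_
          rw [hs, mul_sum]
          exact sum_congr rfl fun l _ => by ring
      _ = ∑ i, ∑ j, ∑ k, ∑ l, (w i * w j * w k * w l * h' i j k l
            + w i * w j * w k * w l * (if l = i then h i j k else 0)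
            + w i * w j * w k * w l * (if l = j then h i j k else 0)
            + w i * w j * w k * w l * (if l = k then h i j k else 0)) := by
          refine sum_congr rfl fun i _ => sum_congr rfl fun j _ => sum_congr rfl fun k _ =>
            sum_congr rfl fun l _ => ?_
          rw [← mul_add, ← mul_add, ← mul_add, ← p]
      _ = _ := by
          simp only [sum_add_distrib]
          rw [q1, q2, q3]
          simp only [mul_add, sum_add_distrib]
          ring
  have split : ∑ i, ∑ j, ∑ k, w i * w j * w k * h i j k
      = ∑ i, ∑ j, ∑ k, w i * w j * w k * z i j k
        - ∑ i, ∑ j, ∑ k, w i * w j * w k * y0 i j k := by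
    simp only [h, mul_sub, sum_sub_distrib]
  -- Term by term this is the four-point inequality for the hub and three outer points.
  have key3 : 0 ≤ ∑ i, ∑ j, ∑ k, w i ^ 2 * w j * w k * x i j k
      + ∑ i, ∑ j, ∑ k, w i ^ 2 * w j * w k * (h i j k + h j i k + h k j i) := by
    simp only [← sum_add_distrib, ← mul_add]
    refine sum_nonneg fun i _ => sum_nonneg fun j _ => sum_nonneg fun k _ => ?_
    refine mul_nonneg (mul_nonneg (mul_nonneg (sq_nonneg _) (hw j)) (hw k)) ?_
    by_cases hc : i = j ∨ i = k ∨ j = k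
    · rw [hx i j k hc, hh i j k hc, hh j i k (by tauto), hh k j i (by tauto)]
      simp
    · push Not at hc
      obtain ⟨c1, c2, c3⟩ := hc
      have := h3 i j k c1 c2 c3
      simp only [h, z, c1, c2, c3, c1.symm, c2.symm, c3.symm, ne_eq, not_false_eq_true, and_self,
        if_true]
      linarith [hy0s k i j, hx0s i j]
  -- The summand has no sign by itself. Summed over the twelve even permutations of its indices it
  -- becomes four times the five-point expression.
  have key4 : 0 ≤ ∑ i, ∑ j, ∑ k, ∑ l, w i * w j * w k * w l * y i j k l
      + 4 * ∑ i, ∑ j, ∑ k, ∑ l, w i * w j * w k * w l * h' i j k l := by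
    let G : W → W → W → W → ℝ := fun i j k l => y i j k l + 4 * h' i j k l
    let g : W → W → W → W → ℝ := fun i j k l => w i * w j * w k * w l * G i j k l
    have hG : ∀ i j k l, (i = j ∨ i = k ∨ i = l ∨ j = k ∨ j = l ∨ k = l) → G i j k l = 0 := by
      intro i j k l hc
      have h1 : y i j k l = 0 := hy i j k l (by
        rcases hc with rfl | rfl | rfl | rfl | rfl | rfl <;> simp)
      have h2 : h' i j k l = 0 := by
        rcases hc with rfl | rfl | rfl | rfl | rfl | rfl <;> simp [h', hh]
      simp [G, h1, h2]
    let g : W → W → W → W → ℝ := fun i j k l => w i * w j * w k * w l * G i j k l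
    have hG : ∀ i j k l, (i = j ∨ i = k ∨ i = l ∨ j = k ∨ j = l ∨ k = l) → G i j k l = 0 := by
      intro i j k l hc
      have : y i j k l = 0 := hy i j k l (by
        simp only [List.nodup_cons, List.mem_cons, List.not_mem_nil, or_false]
        tauto)
      have h2 : h' i j k l = 0 := by
        by_cases hc' : i = j ∨ i = k ∨ j = k
        · simp [h', hh i j k hc']
        · have : ¬ (l ≠ i ∧ l ≠ j ∧ l ≠ k) := by
            rintro ⟨a1, a2, a3⟩
            have := a1.symm
            have := a2.symm
            have := a3.symm
            tauto
          simp [h', this]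
      simp [G, this, h2]
    let P : (W → W → W → W → ℝ) → ℝ := fun F => ∑ i, ∑ j, ∑ k, ∑ l, F i j k l
    have hP : ∑ i, ∑ j, ∑ k, ∑ l, w i * w j * w k * w l * y i j k l
        + 4 * ∑ i, ∑ j, ∑ k, ∑ l, w i * w j * w k * w l * h' i j k l = P g := by
      simp only [P, g, G, mul_add, sum_add_distrib, mul_sum]
      congr 1
      refine sum_congr rfl fun i _ => sum_congr rfl fun j _ => sum_congr rfl fun k _ =>
        sum_congr rfl fun l _ => ?_
      ring
    have hpos : 0 ≤ 12 * P g := by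
      rw [show 12 * P g = _ from sum_four_even_average g]
      refine sum_nonneg fun i _ => sum_nonneg fun j _ => sum_nonneg fun k _ =>
        sum_nonneg fun l _ => ?_
      have factor : g i j k l + g j k i l + g k i j l + g j i l k + g i l j k + g l j i k
            + g k l i j + g l i k j + g i k l j + g l k j i + g k j l i + g j l k i
          = w i * w j * w k * w l *
          (G i j k l + G j k i l + G k i j l + G j i l k + G i l j k + G l j i k
            + G k l i j + G l i k j + G i k l j + G l k j i + G k j l i + G j l k i) := by
        simp only [g]
        ring
      rw [factor]
      refine mul_nonneg (mul_nonneg (mul_nonneg (mul_nonneg (hw i) (hw j)) (hw k)) (hw l)) ?_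
      by_cases hd : i = j ∨ i = k ∨ i = l ∨ j = k ∨ j = l ∨ k = l
      · rcases hd with rfl | rfl | rfl | rfl | rfl | rfl <;> simp [hG]
      · push Not at hd
        obtain ⟨c1, c2, c3, c4, c5, c6⟩ := hd
        have pos := h4 i j k l (by simp [c1, c2, c3, c4, c5, c6])
        have ya : ∀ i j k l, y j i l k = y i j k l := fun i j k l => by
          rw [(hys j i l k).1, (hys i j l k).2.1]
        have yb : ∀ i j k l, y k l i j = y i j k l := fun i j k l => (hys i j k l).2.2.symm
        have yc : ∀ i j k l, y l k j i = y i j k l := fun i j k l => by rw [yb, ya]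
        simp only [G, h', h, z, c1, c2, c3, c4, c5, c6, c1.symm, c2.symm, c3.symm, c4.symm,
          c5.symm, c6.symm, ne_eq, not_false_eq_true, and_self, if_true]
        rw [yb i l j k, (hys k i j l).1, ya i j k l, (hys l j i k).2.2, (hys i k l j).2.1,
          yb i j k l, ya i l j k, yc i j k l, yc i l j k, yb k i j l, (hys k i j l).1]
        linarith [hx0s i j, hx0s i k, hx0s i l, hx0s j k, hx0s j l,
          hx0s k l, hy0s i j k, hy0s i j l, hy0s i k l, hy0s j i k, hy0s j i l, hy0s j k l,
          hy0s k i j, hy0s k i l, hy0s k j l, hy0s l i j, hy0s l i k, hy0s l j k]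
    rw [hP]
    linarith
  have e3 : s ^ 2 * ∑ i, ∑ j, w i * w j * x0 i j = s * ∑ i, ∑ j, ∑ k, w i * w j * w k * z i j k
      + 2 * s * ∑ i, ∑ j, w i ^ 2 * w j * x0 i j := by
    rw [pow_two, mul_assoc, e1]
    ring
  rw [split, mul_sub] at e2
  linarith

end QuarticForms

/-! ### Defects at coinciding indices and the correlation identity -/

section Octopus

open Equiv Finset

variable {V Ω : Type*} [Fintype Ω] [DecidableEq V] (ψ : Perm V →* Perm Ω) (f : Ω → ℝ)

/-- `cycleDefect` on triples of distinct points, and `0` on other triples. -/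
def cycleDefect' (i j k : V) : ℝ :=
  if i = j ∨ i = k ∨ j = k then 0 else cycleDefect ψ f i j k

/-- `pairDefect` on quadruples of distinct points, and `0` on other quadruples. -/
def pairDefect' (i j k l : V) : ℝ :=
  if [i, j, k, l].Nodup then pairDefect ψ f i j k l else 0

theorem swapDefect_self (i : V) : swapDefect ψ f i i = 0 := by
  rw [swapDefect, show swap i i = (1 : Perm V) from swap_self i, map_one, sub_self]

theorem cycleDefect_reverse (i j k : V) : cycleDefect ψ f i j k = cycleDefect ψ f k j i := by
  rw [cycleDefect, cycleDefect, autocorr_swap_mul_swap_comm, swap_comm j k, swap_comm i j]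

theorem cycleDefect_rotate {i j k : V} (h1 : i ≠ j) (h2 : i ≠ k) (h3 : j ≠ k) :
    cycleDefect ψ f i j k = cycleDefect ψ f j k i := by
  have : swap i j * swap j k = swap j k * swap k i := by
    ext x
    simp only [Perm.mul_apply, swap_apply_def]
    grind
  rw [cycleDefect, cycleDefect, this]

theorem cycleDefect'_reverse (i j k : V) : cycleDefect' ψ f i j k = cycleDefect' ψ f k j i := by
  unfold cycleDefect'
  rw [cycleDefect_reverse]
  refine if_congr ?_ rfl rfl
  grind

theorem cycleDefect'_rotate (i j k : V) : cycleDefect' ψ f i j k = cycleDefect' ψ f j k i := by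
  unfold cycleDefect'
  by_cases h : i = j ∨ i = k ∨ j = k
  · rw [if_pos h, if_pos (by grind)]
  · rw [if_neg h, if_neg (by grind)]
    push Not at h
    exact cycleDefect_rotate ψ f h.1 h.2.1 h.2.2

theorem pairDefect'_symm (i j k l : V) :
    pairDefect' ψ f i j k l = pairDefect' ψ f j i k l ∧
    pairDefect' ψ f i j k l = pairDefect' ψ f i j l k ∧
    pairDefect' ψ f i j k l = pairDefect' ψ f k l i j := by
  unfold pairDefect' pairDefect
  refine ⟨?_, ?_, ?_⟩
  · rw [swap_comm i j]
    exact if_congr (List.Perm.nodup_iff (List.Perm.swap _ _ _)) rfl rfl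
  · rw [swap_comm k l]
    refine if_congr ?_ rfl rfl
    simp only [List.nodup_cons, List.mem_cons, List.not_mem_nil, or_false]
    grind
  · rw [autocorr_swap_mul_swap_comm]
    refine if_congr ?_ rfl rfl
    simp only [List.nodup_cons, List.mem_cons, List.not_mem_nil, or_false]
    grind

/-- If the transpositions share one point, their product is a 3-cycle; if one is trivial, the other
remains; if they are equal, the product is the identity and has defect 0. The primed defects vanish
at repeated indices, so overlapping cases are not counted twice. -/
theorem pairDefect_eq (i j k l : V) :
    pairDefect ψ f i j k l = pairDefect' ψ f i j k l
      + (if i = k then cycleDefect' ψ f j i l else 0)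
      + (if i = l then cycleDefect' ψ f j i k else 0)
      + (if j = k then cycleDefect' ψ f i j l else 0)
      + (if j = l then cycleDefect' ψ f i j k else 0)
      + (if i = j then swapDefect ψ f k l else 0)
      + (if k = l then swapDefect ψ f i j else 0) := by
  have one : Equiv.refl V = (1 : Perm V) := rfl
  by_cases hij : i = j
  · subst hij
    by_cases hkl : k = l
    · subst hkl
      simp [pairDefect', cycleDefect', pairDefect, swapDefect, one]
    · simp [pairDefect', cycleDefect', pairDefect, swapDefect, one, hkl]
  by_cases hkl : k = l
  · subst hkl
    by_cases h1 : i = k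
    · subst h1
      simp [pairDefect', cycleDefect', pairDefect, swapDefect, one, hij, Ne.symm hij]
    · by_cases h2 : j = k
      · subst h2
        simp [pairDefect', cycleDefect', pairDefect, swapDefect, one, hij]
      · simp [pairDefect', pairDefect, swapDefect, one, hij, h1, h2]
  by_cases h1 : i = k
  · subst h1
    by_cases h2 : j = l
    · subst h2
      simp [pairDefect', cycleDefect', pairDefect, hij, Ne.symm hij]
    · simp [pairDefect', cycleDefect', pairDefect, cycleDefect, hij, hkl, h2, Ne.symm hij,
        swap_comm j i]
  by_cases h2 : i = l
  · subst h2
    by_cases h3 : j = k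
    · subst h3
      simp [pairDefect', cycleDefect', pairDefect, hij, Ne.symm hij, swap_comm j i]
    · simp [pairDefect', cycleDefect', pairDefect, cycleDefect, hij, hkl, h1, h3, Ne.symm hij,
        swap_comm j i, swap_comm k i]
  by_cases h3 : j = k
  · subst h3
    simp [pairDefect', cycleDefect', pairDefect, cycleDefect, hij, hkl, h2]
  by_cases h4 : j = l
  · subst h4
    simp [pairDefect', cycleDefect', pairDefect, cycleDefect, hij, hkl, h1, h3, swap_comm k j]
  simp [pairDefect', hij, hkl, h1, h2, h3, h4]

variable [Fintype V]

/-- With X = ∑ c_i c_j (i j), the left side is the form of 2|c|² X - X². Since ∑ c = 0, correlations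
turn into minus defects. Four coincidence patterns of `pairDefect_eq` give the 3-cycle sum, and the
other two cancel the term in X. -/
theorem correlation_identity (c : V → ℝ) (hc : ∑ i, c i = 0) :
    2 * (∑ i, c i ^ 2) * ∑ i, ∑ j, c i * c j * autocorr f (ψ (swap i j))
      - ∑ i, ∑ j, ∑ k, ∑ l, c i * c j * c k * c l * autocorr f (ψ (swap i j * swap k l))
      = 4 * ∑ i, ∑ j, ∑ k, c i ^ 2 * c j * c k * cycleDefect' ψ f i j k
        + ∑ i, ∑ j, ∑ k, ∑ l, c i * c j * c k * c l * pairDefect' ψ f i j k l := by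
  set S := ∑ i, ∑ j, ∑ k, c i ^ 2 * c j * c k * cycleDefect' ψ f i j k with hS
  set M := ∑ i, ∑ j, c i * c j * swapDefect ψ f i j with hM
  have hM' : M = - ∑ i, ∑ j, c i * c j * autocorr f (ψ (swap i j)) := by
    simp only [hM, swapDefect, mul_sub, sum_sub_distrib]
    simp only [← sum_mul, ← mul_sum, hc]
    simp
  have hB : ∑ i, ∑ j, ∑ k, ∑ l, c i * c j * c k * c l * pairDefect ψ f i j k l
      = - ∑ i, ∑ j, ∑ k, ∑ l, c i * c j * c k * c l * autocorr f (ψ (swap i j * swap k l)) := by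
    simp only [pairDefect, mul_sub, sum_sub_distrib]
    simp only [← sum_mul, ← mul_sum, hc]
    simp
  have t1 : ∑ i, ∑ j, ∑ k, ∑ l, c i * c j * c k * c l *
      (if i = k then cycleDefect' ψ f j i l else 0) = S := by
    refine sum_congr rfl fun i _ => sum_congr rfl fun j _ => ?_
    rw [sum_comm]
    refine sum_congr rfl fun k _ => ?_
    simp only [mul_ite, mul_zero, sum_ite_eq, mem_univ, if_true]
    rw [cycleDefect'_rotate, cycleDefect'_reverse ψ f i k j, cycleDefect'_rotate ψ f j k i,
      cycleDefect'_rotate, cycleDefect'_reverse ψ f i j k,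
      ← cycleDefect'_reverse ψ f i j k]
    ring
  have t2 : ∑ i, ∑ j, ∑ k, ∑ l, c i * c j * c k * c l *
      (if i = l then cycleDefect' ψ f j i k else 0) = S := by
    refine sum_congr rfl fun i _ => sum_congr rfl fun j _ => sum_congr rfl fun k _ => ?_
    simp only [mul_ite, mul_zero, sum_ite_eq, mem_univ, if_true]
    rw [cycleDefect'_rotate ψ f j i k, cycleDefect'_reverse ψ f i k j,
      cycleDefect'_rotate ψ f j k i, cycleDefect'_rotate ψ f k i j]
    ring
  have t3 : ∑ i, ∑ j, ∑ k, ∑ l, c i * c j * c k * c l *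
      (if j = k then cycleDefect' ψ f i j l else 0) = S := by
    rw [sum_comm]
    refine Eq.trans ?_ t1
    refine sum_congr rfl fun i _ => sum_congr rfl fun j _ => sum_congr rfl fun k _ =>
      sum_congr rfl fun l _ => ?_
    ring
  have t4 : ∑ i, ∑ j, ∑ k, ∑ l, c i * c j * c k * c l *
      (if j = l then cycleDefect' ψ f i j k else 0) = S := by
    rw [sum_comm]
    refine Eq.trans ?_ t2
    refine sum_congr rfl fun i _ => sum_congr rfl fun j _ => sum_congr rfl fun k _ =>
      sum_congr rfl fun l _ => ?_
    ring
  have t5 : ∑ i, ∑ j, ∑ k, ∑ l, c i * c j * c k * c l *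
      (if i = j then swapDefect ψ f k l else 0) = (∑ i, c i ^ 2) * M := by
    rw [sum_mul]
    refine sum_congr rfl fun i _ => ?_
    rw [sum_eq_single i (by
      intro b _ hb
      simp [Ne.symm hb]) (by simp), hM, mul_sum]
    refine sum_congr rfl fun k _ => ?_
    rw [mul_sum]
    refine sum_congr rfl fun l _ => ?_
    simp only [if_true]
    ring
  have t6 : ∑ i, ∑ j, ∑ k, ∑ l, c i * c j * c k * c l *
      (if k = l then swapDefect ψ f i j else 0) = (∑ i, c i ^ 2) * M := by
    rw [hM, mul_sum]
    refine sum_congr rfl fun i _ => ?_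
    rw [mul_sum]
    refine sum_congr rfl fun j _ => ?_
    rw [sum_mul]
    refine sum_congr rfl fun k _ => ?_
    simp only [mul_ite, mul_zero, sum_ite_eq, mem_univ, if_true]
    ring
  have hsum : ∑ i, ∑ j, ∑ k, ∑ l, c i * c j * c k * c l * pairDefect ψ f i j k l
      = ∑ i, ∑ j, ∑ k, ∑ l, c i * c j * c k * c l * pairDefect' ψ f i j k l
        + S + S + S + S + (∑ i, c i ^ 2) * M + (∑ i, c i ^ 2) * M := by
    calc _ = ∑ i, ∑ j, ∑ k, ∑ l, (c i * c j * c k * c l * pairDefect' ψ f i j k l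
          + c i * c j * c k * c l * (if i = k then cycleDefect' ψ f j i l else 0)
          + c i * c j * c k * c l * (if i = l then cycleDefect' ψ f j i k else 0)
          + c i * c j * c k * c l * (if j = k then cycleDefect' ψ f i j l else 0)
          + c i * c j * c k * c l * (if j = l then cycleDefect' ψ f i j k else 0)
          + c i * c j * c k * c l * (if i = j then swapDefect ψ f k l else 0)
          + c i * c j * c k * c l * (if k = l then swapDefect ψ f i j else 0)) := ?_
      _ = _ := by
          simp only [sum_add_distrib]
          rw [t1, t2, t3, t4, t5, t6]
    refine sum_congr rfl fun i _ => sum_congr rfl fun j _ => sum_congr rfl fun k _ =>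
      sum_congr rfl fun l _ => ?_
    rw [pairDefect_eq]
    ring
  rw [hB, hM'] at hsum
  linarith

/-- X is self-adjoint, so the form of X² is ‖Xf‖². -/
theorem sum_autocorr_swaps_eq_sq (c : V → ℝ) :
    ∑ i, ∑ j, ∑ k, ∑ l, c i * c j * c k * c l * autocorr f (ψ (swap i j * swap k l))
      = ∑ ω, (∑ i, ∑ j, c i * c j * f (ψ (swap i j) ω)) ^ 2 := by
  have : ∀ i j k l, autocorr f (ψ (swap i j * swap k l))
      = ∑ ω, f (ψ (swap k l) ω) * f (ψ (swap i j) ω) := by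
    intro i j k l
    rw [map_mul, ← autocorr_mul_inv, ← map_inv, swap_inv]
  simp only [this, mul_sum]
  have h1 : ∀ ω, (∑ i, ∑ j, c i * c j * f (ψ (swap i j) ω)) ^ 2
      = ∑ i, ∑ j, ∑ k, ∑ l,
        c i * c j * c k * c l * (f (ψ (swap k l) ω) * f (ψ (swap i j) ω)) := by
    intro ω
    rw [pow_two, sum_mul]
    refine sum_congr rfl fun i _ => ?_
    rw [sum_mul]
    refine sum_congr rfl fun j _ => ?_
    rw [mul_sum]
    refine sum_congr rfl fun k _ => ?_
    rw [mul_sum]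
    refine sum_congr rfl fun l _ => ?_
    ring
  simp only [h1]
  symm
  rw [sum_comm]
  refine sum_congr rfl fun i _ => ?_
  rw [sum_comm]
  refine sum_congr rfl fun j _ => ?_
  rw [sum_comm]
  refine sum_congr rfl fun k _ => ?_
  rw [sum_comm]

end Octopus

/-! ### The octopus inequality -/

section Octopus

open Equiv Finset

variable {V Ω : Type*} [Fintype Ω]

theorem two_mul_swapDefect [DecidableEq V] (ψ : Perm V →* Perm Ω) (f : Ω → ℝ) (i j : V) :
    2 * swapDefect ψ f i j = ∑ ω, (f (ψ (swap i j) ω) - f ω) ^ 2 := by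
  have h : ∑ ω, f (ψ (swap i j) ω) ^ 2 = ∑ ω, f ω ^ 2 :=
    Equiv.sum_comp (ψ (swap i j)) fun ω => f ω ^ 2
  have h2 : ∑ ω, (f (ψ (swap i j) ω) - f ω) ^ 2
      = ∑ ω, f (ψ (swap i j) ω) ^ 2 + ∑ ω, f ω ^ 2 - 2 * ∑ ω, f ω * f (ψ (swap i j) ω) := by
    rw [mul_sum, ← sum_add_distrib, ← sum_sub_distrib]
    exact sum_congr rfl fun ω _ => by ring
  rw [h2, h, swapDefect, autocorr, autocorr]
  simp only [Perm.one_apply, ← pow_two]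
  ring

theorem swapDefect_nonneg [DecidableEq V] (ψ : Perm V →* Perm Ω) (f : Ω → ℝ) (i j : V) :
    0 ≤ swapDefect ψ f i j := by
  have := two_mul_swapDefect ψ f i j
  have : 0 ≤ ∑ ω, (f (ψ (swap i j) ω) - f ω) ^ 2 := sum_nonneg fun _ _ => sq_nonneg _
  linarith

variable {W : Type*} [Fintype W] [DecidableEq W] (ψ : Perm (Option W) →* Perm Ω) (f : Ω → ℝ)

/-- Separating the hub `none` turns the quartic form into that of `quartic_form_nonneg`. The hub
carries weight -s: squared in a 3-cycle term it gives s², in a linear slot -s, and in a pair term it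
can occupy any of four equivalent slots. -/
theorem octopus_quartic_nonneg (w : W → ℝ) (hw : ∀ i, 0 ≤ w i) (c : Option W → ℝ)
    (hc0 : c none = - ∑ i, w i) (hc : ∀ i, c (some i) = w i) :
    0 ≤ 4 * ∑ i, ∑ j, ∑ k, c i ^ 2 * c j * c k * cycleDefect' ψ f i j k
        + ∑ i, ∑ j, ∑ k, ∑ l, c i * c j * c k * c l * pairDefect' ψ f i j k l := by
  have main := quartic_form_nonneg w hw
    (fun i j k => cycleDefect' ψ f (some i) (some j) (some k))
    (fun i j => cycleDefect' ψ f none (some i) (some j))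
    (fun i j k l => pairDefect' ψ f (some i) (some j) (some k) (some l))
    (fun i j k => pairDefect' ψ f none (some i) (some j) (some k))
    (fun i j k h => by simp [cycleDefect', h])
    (fun i => by simp [cycleDefect'])
    (fun i j => by
      rw [cycleDefect'_rotate, cycleDefect'_reverse])
    (fun i j k l h => by
      rw [pairDefect', if_neg]
      simpa using h)
    (fun i j k l => pairDefect'_symm ψ f _ _ _ _)
    (fun i j k h => by
      rw [pairDefect', if_neg]
      rcases h with rfl | rfl | rfl <;> simp)
    (fun i j k => (pairDefect'_symm ψ f _ _ _ _).2.1)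
    (fun i j k h1 h2 h3 => by
      have := four_point_nonneg ψ f none (some i) (some j) (some k) (by simp [h1, h2, h3])
      simpa [cycleDefect', pairDefect', h1, h2, h3, h1.symm, h2.symm, h3.symm] using this)
    (fun i j k l h => by
      have := five_point_nonneg ψ f none (some i) (some j) (some k) (some l) (by simpa using h)
      simp only [List.nodup_cons, List.mem_cons, List.not_mem_nil, or_false, not_or] at h
      obtain ⟨⟨c1, c2, c3⟩, ⟨c4, c5⟩, c6, -⟩ := h
      simpa [cycleDefect', pairDefect', c1, c2, c3, c4, c5, c6, Ne.symm c1, Ne.symm c2,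
        Ne.symm c3, Ne.symm c4, Ne.symm c5, Ne.symm c6] using this)
  set s := ∑ i, w i with hs
  have v1 : ∀ i, cycleDefect' ψ f none none i = 0 := fun i => by simp [cycleDefect']
  have v2 : ∀ i, cycleDefect' ψ f none i none = 0 := fun i => by simp [cycleDefect']
  have v3 : ∀ i, cycleDefect' ψ f i none none = 0 := fun i => by simp [cycleDefect']
  have u1 : ∀ i j, pairDefect' ψ f none none i j = 0 := fun i j => by simp [pairDefect']
  have u2 : ∀ i j, pairDefect' ψ f none i none j = 0 := fun i j => by simp [pairDefect']
  have u3 : ∀ i j, pairDefect' ψ f none i j none = 0 := fun i j => by simp [pairDefect']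
  have u4 : ∀ i j, pairDefect' ψ f i none none j = 0 := fun i j => by simp [pairDefect']
  have u5 : ∀ i j, pairDefect' ψ f i none j none = 0 := fun i j => by simp [pairDefect']
  have u6 : ∀ i j, pairDefect' ψ f i j none none = 0 := fun i j => by simp [pairDefect']
  set A := ∑ i, ∑ j, ∑ k, w i ^ 2 * w j * w k * cycleDefect' ψ f (some i) (some j) (some k)
  set B := ∑ i, ∑ j, w i * w j * cycleDefect' ψ f none (some i) (some j)
  set C := ∑ i, ∑ j, w i ^ 2 * w j * cycleDefect' ψ f none (some i) (some j) with hC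
  set E := ∑ i, ∑ j, ∑ k, ∑ l,
    w i * w j * w k * w l * pairDefect' ψ f (some i) (some j) (some k) (some l)
  set F := ∑ i, ∑ j, ∑ k, w i * w j * w k * pairDefect' ψ f none (some i) (some j) (some k) with hF
  have e3 : ∑ i, ∑ j, ∑ k, c i ^ 2 * c j * c k * cycleDefect' ψ f i j k
      = A + s ^ 2 * B - 2 * s * C := by
    simp only [Fintype.sum_option, hc0, hc, v1, v2, v3, mul_zero, sum_const_zero, zero_add,
      sum_add_distrib]
    have p0 : ∑ i, ∑ j, (-s) ^ 2 * w i * w j * cycleDefect' ψ f none (some i) (some j)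
        = s ^ 2 * B := by
      simp only [B, mul_sum]
      exact sum_congr rfl fun i _ => sum_congr rfl fun j _ => by ring
    have p1 : ∑ i, ∑ j, w i ^ 2 * -s * w j * cycleDefect' ψ f (some i) none (some j)
        = -s * C := by
      simp only [C, mul_sum]
      refine sum_congr rfl fun i _ => sum_congr rfl fun j _ => ?_
      rw [cycleDefect'_reverse, cycleDefect'_rotate, cycleDefect'_rotate]
      ring
    have p2 : ∑ i, ∑ j, w i ^ 2 * w j * -s * cycleDefect' ψ f (some i) (some j) none
        = -s * C := by
      simp only [C, mul_sum]
      refine sum_congr rfl fun i _ => sum_congr rfl fun j _ => ?_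
      rw [cycleDefect'_rotate ψ f none]
      ring
    rw [p0, p1, p2]
    ring
  have e4 : ∑ i, ∑ j, ∑ k, ∑ l, c i * c j * c k * c l * pairDefect' ψ f i j k l
      = E - 4 * s * F := by
    simp only [Fintype.sum_option, hc0, hc, u1, u2, u3, u4, u5, u6, mul_zero, sum_const_zero,
      zero_add, sum_add_distrib]
    have p0 : ∑ i, ∑ j, ∑ k, -s * w i * w j * w k *
        pairDefect' ψ f none (some i) (some j) (some k) = -s * F := by
      simp only [F, mul_sum]
      exact sum_congr rfl fun i _ => sum_congr rfl fun j _ => sum_congr rfl fun k _ => by ring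
    have p1 : ∑ i, ∑ j, ∑ k, w i * -s * w j * w k *
        pairDefect' ψ f (some i) none (some j) (some k) = -s * F := by
      simp only [F, mul_sum]
      refine sum_congr rfl fun i _ => sum_congr rfl fun j _ => sum_congr rfl fun k _ => ?_
      rw [(pairDefect'_symm ψ f (some i) none _ _).1]
      ring
    have p2 : ∑ i, ∑ j, ∑ k, w i * w j * -s * w k *
        pairDefect' ψ f (some i) (some j) none (some k) = -s * F := by
      rw [sum_three_swap_last, sum_three_swap_first]
      simp only [F, mul_sum]
      refine sum_congr rfl fun i _ => sum_congr rfl fun j _ => sum_congr rfl fun k _ => ?_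
      rw [(pairDefect'_symm ψ f (some j) (some k) _ _).2.2]
      ring
    have p3 : ∑ i, ∑ j, ∑ k, w i * w j * w k * -s *
        pairDefect' ψ f (some i) (some j) (some k) none = -s * F := by
      rw [← p2]
      refine sum_congr rfl fun i _ => sum_congr rfl fun j _ => sum_congr rfl fun k _ => ?_
      rw [(pairDefect'_symm ψ f (some i) (some j) _ _).2.1]
      ring
    rw [p0, p1, p2, p3]
    ring
  rw [e3, e4]
  linarith

/-- The octopus inequality of Caputo, Liggett and Richthammer, as positivity of a quadratic form. -/
theorem octopus_form_nonneg (w : W → ℝ) (hw : ∀ i, 0 ≤ w i) (c : Option W → ℝ)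
    (hc0 : c none = - ∑ i, w i) (hc : ∀ i, c (some i) = w i) :
    0 ≤ ∑ i, ∑ j, c i * c j * autocorr f (ψ (swap i j)) := by
  have hsum : ∑ i, c i = 0 := by
    simp [Fintype.sum_option, hc0, hc]
  have h1 := correlation_identity ψ f c hsum
  have h2 := octopus_quartic_nonneg ψ f w hw c hc0 hc
  have h3 : 0 ≤ ∑ i, ∑ j, ∑ k, ∑ l,
      c i * c j * c k * c l * autocorr f (ψ (swap i j * swap k l)) := by
    rw [sum_autocorr_swaps_eq_sq]
    positivity
  have hq : 0 ≤ ∑ i, c i ^ 2 := sum_nonneg fun _ _ => sq_nonneg _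
  rcases hq.eq_or_lt with h0 | h0
  · have : ∀ i, c i = 0 := by
      intro i
      have := (sum_eq_zero_iff_of_nonneg fun i _ => sq_nonneg (c i)).1 h0.symm i (mem_univ i)
      exact pow_eq_zero_iff (two_ne_zero) |>.1 this
    simp [this]
  -- This is 2|c|² ⟨f, Xf⟩ = ‖Xf‖² + quartic form, with both summands nonnegative.
  · refine nonneg_of_mul_nonneg_right (a := 2 * ∑ i, c i ^ 2) ?_ (by positivity)
    linarith

/-- The octopus inequality of Caputo, Liggett and Richthammer. -/
theorem octopus_inequality (w : W → ℝ) (hw : ∀ i, 0 ≤ w i) :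
    ∑ y, ∑ z, w y * w z / (∑ i, w i) * swapDefect ψ f (some y) (some z)
      ≤ 2 * ∑ y, w y * swapDefect ψ f none (some y) := by
  set s := ∑ i, w i with hs
  have hs0 : 0 ≤ s := sum_nonneg fun i _ => hw i
  rcases hs0.eq_or_lt with h0 | h0
  · rw [← h0]
    simp only [div_zero, zero_mul, sum_const_zero]
    have : 0 ≤ ∑ y, w y * swapDefect ψ f none (some y) :=
      sum_nonneg fun y _ => mul_nonneg (hw y) (swapDefect_nonneg ψ f _ _)
    linarith
  let c : Option W → ℝ := fun o => o.elim (-s) w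
  have h := octopus_form_nonneg ψ f w hw c rfl fun i => rfl
  have hsum : ∑ i, c i = 0 := by
    simp [Fintype.sum_option, c, hs]
  have h2 : ∑ i, ∑ j, c i * c j * swapDefect ψ f i j
      = - ∑ i, ∑ j, c i * c j * autocorr f (ψ (swap i j)) := by
    simp only [swapDefect, mul_sub, sum_sub_distrib]
    simp only [← sum_mul, ← mul_sum, hsum]
    simp
  have h3 : ∑ i, ∑ j, c i * c j * swapDefect ψ f i j
      = ∑ y, ∑ z, w y * w z * swapDefect ψ f (some y) (some z)
        - 2 * s * ∑ y, w y * swapDefect ψ f none (some y) := by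
    have hsymm : ∀ y, swapDefect ψ f (some y) none = swapDefect ψ f none (some y) := fun y => by
      rw [swapDefect, swap_comm, ← swapDefect]
    simp only [Fintype.sum_option, c, Option.elim, swapDefect_self, mul_zero, zero_add, hsymm,
      sum_add_distrib]
    have p0 : ∑ y, -s * w y * swapDefect ψ f none (some y)
        = -s * ∑ y, w y * swapDefect ψ f none (some y) := by
      rw [mul_sum]
      exact sum_congr rfl fun y _ => by ring
    have p1 : ∑ y, w y * -s * swapDefect ψ f none (some y)
        = -s * ∑ y, w y * swapDefect ψ f none (some y) := by
      rw [mul_sum]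
      exact sum_congr rfl fun y _ => by ring
    rw [p0, p1]
    ring
  have h4 : ∑ y, ∑ z, w y * w z / s * swapDefect ψ f (some y) (some z)
      = (∑ y, ∑ z, w y * w z * swapDefect ψ f (some y) (some z)) / s := by
    rw [sum_div]
    refine sum_congr rfl fun y _ => ?_
    rw [sum_div]
    exact sum_congr rfl fun z _ => by ring
  rw [h4, div_le_iff₀ h0]
  linarith

end Octopus

/-! ### Reductions for the spectral gap theorem -/

section Aldous

open Equiv Finset

/-- A symmetric operator that kills constants is bounded below by `lam` on mean-zero functions if
its mean-zero eigenvectors have eigenvalues at least `lam`. -/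
theorem rayleigh_bound_of_eigenvectors {Ω : Type*} [Fintype Ω] (T : (Ω → ℝ) →ₗ[ℝ] (Ω → ℝ))
    (hsymm : ∀ f g, ∑ ω, T f ω * g ω = ∑ ω, f ω * T g ω) (hone : T (fun _ => 1) = 0)
    (lam : ℝ) (hlam : 0 < lam)
    (heig : ∀ (μ : ℝ) (f : Ω → ℝ), f ≠ 0 → ∑ ω, f ω = 0 → T f = μ • f → lam ≤ μ)
    (f : Ω → ℝ) (hf : ∑ ω, f ω = 0) :
    lam * ∑ ω, f ω ^ 2 ≤ ∑ ω, f ω * T f ω := by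
  let e := WithLp.linearEquiv 2 ℝ (Ω → ℝ)
  let T' : EuclideanSpace ℝ Ω →ₗ[ℝ] EuclideanSpace ℝ Ω := e.symm.toLinearMap ∘ₗ T ∘ₗ e.toLinearMap
  have hT'app : ∀ x ω, T' x ω = T (e x) ω := fun x ω => rfl
  have hinner : ∀ x y : EuclideanSpace ℝ Ω, inner ℝ x y = ∑ ω, x ω * y ω := by
    intro x y
    simp [PiLp.inner_apply, mul_comm]
  have hT' : T'.IsSymmetric := by
    intro x y
    rw [hinner, hinner]
    exact hsymm (e x) (e y)
  let b := hT'.eigenvectorBasis rfl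
  let μ := hT'.eigenvalues rfl
  have hb : ∀ i, T (e (b i)) = μ i • e (b i) := by
    intro i
    have := hT'.apply_eigenvectorBasis rfl i
    have h2 := congrArg e this
    exact h2
  let x : EuclideanSpace ℝ Ω := e.symm f
  have h1 : ∑ ω, f ω ^ 2 = ∑ i, inner ℝ (b i) x ^ 2 := by
    rw [OrthonormalBasis.sum_sq_inner_right, ← real_inner_self_eq_norm_sq, hinner]
    exact sum_congr rfl fun ω _ => pow_two _
  have h2 : ∑ ω, f ω * T f ω = ∑ i, μ i * inner ℝ (b i) x ^ 2 := by
    have : ∑ ω, f ω * T f ω = inner ℝ x (T' x) := by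
      rw [hinner]
      rfl
    rw [this, ← OrthonormalBasis.sum_inner_mul_inner b]
    refine sum_congr rfl fun i _ => ?_
    rw [← hT' (b i) x, hT'.apply_eigenvectorBasis rfl i, real_inner_comm (b i) x]
    simp only [inner_smul_left]
    simp only [μ, b, RCLike.ofReal_real_eq_id, id_eq, conj_trivial]
    ring
  rw [h1, h2, mul_sum]
  refine sum_le_sum fun i _ => ?_
  have hne : e (b i) ≠ 0 := by
    intro h
    exact b.toBasis.ne_zero i (by simpa using h)
  -- An eigenvector not orthogonal to the constants has eigenvalue 0. It must itself be constant,
  -- since otherwise subtracting its mean would give a mean-zero null vector, contrary to lam > 0.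
  -- So it does not contribute to f.
  by_cases hs : ∑ ω, e (b i) ω = 0
  · exact mul_le_mul_of_nonneg_right (heig (μ i) _ hne hs (hb i)) (sq_nonneg _)
  · have hμ : μ i = 0 := by
      have h3 := hsymm (fun _ => 1) (e (b i))
      rw [hone, hb] at h3
      simp only [Pi.zero_apply, zero_mul, sum_const_zero, Pi.smul_apply, one_mul, smul_eq_mul,
        ← mul_sum] at h3
      exact (mul_eq_zero.1 h3.symm).resolve_right hs
    have hcard : (Fintype.card Ω : ℝ) ≠ 0 := by
      intro h0
      have : IsEmpty Ω := Fintype.card_eq_zero_iff.1 (by exact_mod_cast h0)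
      exact hs (by simp)
    set a : ℝ := (∑ ω, e (b i) ω) / Fintype.card Ω with ha
    have hconst : e (b i) - a • (fun _ => (1 : ℝ)) = 0 := by
      by_contra hne'
      have := heig 0 _ hne' (by
        simp only [Pi.sub_apply, Pi.smul_apply, smul_eq_mul, mul_one, sum_sub_distrib, sum_const,
          card_univ, nsmul_eq_mul, ha]
        field_simp
        ring) (by
        rw [map_sub, map_smul, hone, hb, hμ]
        simp)
      linarith
    have h0 : inner ℝ (b i) x = 0 := by
      rw [hinner]
      have h4 : ∀ ω, (b i) ω = a := by
        intro ω
        have := congrFun hconst ω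
        simp only [Pi.sub_apply, Pi.smul_apply, smul_eq_mul, mul_one, Pi.zero_apply] at this
        have h5 : e (b i) ω = a := by linarith
        exact h5
      simp only [h4, ← mul_sum]
      rw [show ∑ ω, x ω = 0 from hf, mul_zero]
    rw [h0]
    simp

theorem swapDefect_id {V : Type*} [Fintype V] [DecidableEq V] (φ : V → ℝ) (u v : V) :
    swapDefect (MonoidHom.id (Perm V)) φ u v = (φ u - φ v) ^ 2 := by
  have h := two_mul_swapDefect (MonoidHom.id (Perm V)) φ u v
  by_cases huv : u = v
  · subst huv
    rw [swapDefect_self]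
    ring
  · have : ∑ x, (φ (swap u v x) - φ x) ^ 2 = ∑ x ∈ {u, v}, (φ (swap u v x) - φ x) ^ 2 := by
      symm
      refine sum_subset (subset_univ _) fun x _ hx => ?_
      simp only [mem_insert, mem_singleton, not_or] at hx
      rw [swap_apply_of_ne_of_ne hx.1 hx.2]
      ring
    simp only [MonoidHom.id_apply] at h
    rw [this, sum_pair huv, swap_apply_left, swap_apply_right] at h
    linarith

section Regular

variable {V : Type*} [Fintype V] [DecidableEq V]

/-- The left regular representation of a permutation group. -/
def regularHom (V : Type*) : Perm V →* Perm (Perm V) := MulAction.toPermHom (Perm V) (Perm V)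

theorem regularHom_apply {V : Type*} (g h : Perm V) : regularHom V g h = g * h := rfl

/-- A lower bound for a Dirichlet form on mean-zero functions on the group transfers to all
permutation representations. -/
theorem dirichlet_bound_of_regular (c : V → V → ℝ) (lam : ℝ)
    (hreg : ∀ f : Perm V → ℝ, ∑ g, f g = 0 →
      lam * ∑ g, f g ^ 2 ≤ (∑ u, ∑ v, c u v * swapDefect (regularHom V) f u v) / 2)
    {Ω : Type*} [Fintype Ω] (ψ : Perm V →* Perm Ω) (f : Ω → ℝ)
    (hf : ∀ ω, ∑ g, f (ψ g ω) = 0) :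
    lam * ∑ ω, f ω ^ 2 ≤ (∑ u, ∑ v, c u v * swapDefect ψ f u v) / 2 := by
  have hN : (0 : ℝ) < Fintype.card (Perm V) := by exact_mod_cast Fintype.card_pos
  -- The bound on the group is applied to each orbit function g ↦ f(ψ g ω) and summed over ω; every
  -- sum over Ω is then counted once for each group element.
  have avg : ∀ F : Ω → ℝ, ∑ ω, ∑ g, F (ψ g ω) = Fintype.card (Perm V) * ∑ ω, F ω := by
    intro F
    rw [sum_comm, sum_congr rfl fun g _ => Equiv.sum_comp (ψ g) F]
    simp
  have h1 := avg fun ω => f ω ^ 2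
  have h2 : ∀ u v, ∑ ω, swapDefect (regularHom V) (fun g => f (ψ g ω)) u v
      = Fintype.card (Perm V) * swapDefect ψ f u v := by
    intro u v
    have h3 : ∀ ω, 2 * swapDefect (regularHom V) (fun g => f (ψ g ω)) u v
        = ∑ g, (f (ψ (swap u v) (ψ g ω)) - f (ψ g ω)) ^ 2 := by
      intro ω
      rw [two_mul_swapDefect]
      simp [regularHom_apply]
    have h4 : 2 * ∑ ω, swapDefect (regularHom V) (fun g => f (ψ g ω)) u v
        = 2 * (Fintype.card (Perm V) * swapDefect ψ f u v) := by
      rw [mul_sum, sum_congr rfl fun ω _ => h3 ω, avg fun ω => (f (ψ (swap u v) ω) - f ω) ^ 2,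
        ← two_mul_swapDefect]
      ring
    linarith
  have h5 := sum_le_sum fun ω (_ : ω ∈ (univ : Finset Ω)) => hreg (fun g => f (ψ g ω)) (hf ω)
  rw [← mul_sum, h1, ← sum_div, sum_comm] at h5
  have h6 : ∑ u, ∑ ω, ∑ v, c u v * swapDefect (regularHom V) (fun g => f (ψ g ω)) u v
      = Fintype.card (Perm V) * ∑ u, ∑ v, c u v * swapDefect ψ f u v := by
    rw [mul_sum]
    refine sum_congr rfl fun u _ => ?_
    rw [sum_comm, mul_sum]
    refine sum_congr rfl fun v _ => ?_
    rw [← mul_sum, h2]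
    ring
  rw [h6] at h5
  refine le_of_mul_le_mul_left ?_ hN
  linarith

/-- Occupation sums of an eigenfunction on the group are eigenfunctions on the vertices, so that
they vanish if the eigenvalue lies below the bound for the vertices. -/
theorem occupation_sum_eq_zero (c : V → V → ℝ) (lam μ : ℝ) (hμ : μ < lam)
    (hRW : ∀ φ : V → ℝ, ∑ v, φ v = 0 →
      lam * ∑ v, φ v ^ 2 ≤ (∑ u, ∑ v, c u v * (φ u - φ v) ^ 2) / 2)
    (f : Perm V → ℝ) (hf : ∑ g, f g = 0)
    (hfe : ∀ g, (∑ u, ∑ v, c u v * (f g - f (swap u v * g))) / 2 = μ * f g) (i x : V) :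
    ∑ g, (if g i = x then f g else 0) = 0 := by
  let φ : V → ℝ := fun x => ∑ g, (if g i = x then f g else 0)
  have hφ : ∑ x, φ x = 0 := by
    simp only [φ]
    rw [sum_comm]
    simpa using hf
  have hshift : ∀ u v x, ∑ g, (if g i = x then f (swap u v * g) else 0) = φ (swap u v x) := by
    intro u v x
    simp only [φ]
    rw [← Equiv.sum_comp (Equiv.mulLeft (swap u v)) fun g => if g i = swap u v x then f g else 0]
    refine sum_congr rfl fun g _ => ?_
    simp
  have heig : ∀ x, (∑ u, ∑ v, c u v * (φ x - φ (swap u v x))) / 2 = μ * φ x := by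
    intro x
    have h1 : μ * φ x = ∑ g, (if g i = x then
        (∑ u, ∑ v, c u v * (f g - f (swap u v * g))) / 2 else 0) := by
      simp only [φ, mul_sum]
      refine sum_congr rfl fun g _ => ?_
      rw [hfe g]
      split_ifs <;> simp
    have h2 : ∀ g, (if g i = x then (∑ u, ∑ v, c u v * (f g - f (swap u v * g))) / 2 else 0)
        = (∑ u, ∑ v, c u v * ((if g i = x then f g else 0)
          - (if g i = x then f (swap u v * g) else 0))) / 2 := by
      intro g
      split_ifs <;> simp
    rw [h1, sum_congr rfl fun g _ => h2 g, ← sum_div]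
    congr 1
    symm
    rw [sum_comm]
    refine sum_congr rfl fun u _ => ?_
    rw [sum_comm]
    refine sum_congr rfl fun v _ => ?_
    rw [← mul_sum, sum_sub_distrib, hshift]
  have hform : μ * ∑ x, φ x ^ 2 = (∑ u, ∑ v, c u v * (φ u - φ v) ^ 2) / 2 := by
    have h1 : ∀ x, μ * φ x ^ 2 = (∑ u, ∑ v, c u v * (φ x ^ 2 - φ x * φ (swap u v x))) / 2 := by
      intro x
      rw [pow_two, ← mul_assoc, ← heig x, div_mul_eq_mul_div, sum_mul]
      congr 1
      refine sum_congr rfl fun u _ => ?_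
      rw [sum_mul]
      exact sum_congr rfl fun v _ => by ring
    rw [mul_sum, sum_congr rfl fun x _ => h1 x, ← sum_div]
    congr 1
    rw [sum_comm]
    refine sum_congr rfl fun u _ => ?_
    rw [sum_comm]
    refine sum_congr rfl fun v _ => ?_
    rw [← mul_sum, ← swapDefect_id, swapDefect, autocorr, autocorr, sum_sub_distrib]
    simp [pow_two]
  have h3 := hRW φ hφ
  rw [← hform] at h3
  have h4 : 0 ≤ ∑ x, φ x ^ 2 := sum_nonneg fun _ _ => sq_nonneg _
  have h5 : ∑ x, φ x ^ 2 = 0 := by nlinarith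
  have := (sum_eq_zero_iff_of_nonneg fun x _ => sq_nonneg (φ x)).1 h5 x (mem_univ x)
  exact pow_eq_zero_iff two_ne_zero |>.1 this

end Regular

section Reduction

variable {W : Type*} [Fintype W]

/-- Removing a vertex with the associated reduction of the rates preserves lower bounds for the
Dirichlet form of the random walk. -/
theorem walk_bound_reduced (c : Option W → Option W → ℝ) (hsymm : ∀ u v, c u v = c v u)
    (hc : ∀ u v, 0 ≤ c u v) (lam : ℝ) (hlam : 0 ≤ lam)
    (hRW : ∀ φ : Option W → ℝ, ∑ v, φ v = 0 →
      lam * ∑ v, φ v ^ 2 ≤ (∑ u, ∑ v, c u v * (φ u - φ v) ^ 2) / 2)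
    (φ : W → ℝ) (hφ : ∑ v, φ v = 0) :
    lam * ∑ v, φ v ^ 2 ≤ (∑ u, ∑ v, (c (some u) (some v)
      + c none (some u) * c none (some v) / ∑ w, c none (some w)) * (φ u - φ v) ^ 2) / 2 := by
  set w : W → ℝ := fun u => c none (some u) with hw
  set s := ∑ u, w u with hs
  -- The value at the removed vertex that minimizes the energy: with it, the energy of the star
  -- equals that of the extra rates w_u w_v / s. If s = 0, all w vanish and both energies are 0.
  set m := (∑ u, w u * φ u) / s with hm
  let Φ : Option W → ℝ := fun o => o.elim m φ
  set a : ℝ := m / Fintype.card (Option W) with ha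
  have hcard : (0 : ℝ) < Fintype.card (Option W) := by exact_mod_cast Fintype.card_pos
  have h1 := hRW (fun o => Φ o - a) (by
    rw [sum_sub_distrib, Fintype.sum_option]
    simp only [Φ, Option.elim, hφ, sum_const, card_univ, nsmul_eq_mul, ha]
    field_simp
    ring)
  -- Since φ has mean zero, extending and recentring cannot decrease the sum of squares.
  have h2 : ∑ v, φ v ^ 2 ≤ ∑ o, (Φ o - a) ^ 2 := by
    rw [Fintype.sum_option]
    have h3 : ∑ v, (Φ (some v) - a) ^ 2 = ∑ v, φ v ^ 2 + Fintype.card W * a ^ 2 := by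
      have : ∀ v, (Φ (some v) - a) ^ 2 = φ v ^ 2 - 2 * a * φ v + a ^ 2 := fun v => by
        simp only [Φ, Option.elim]
        ring
      simp only [this, sum_add_distrib, sum_sub_distrib, ← mul_sum, hφ, sum_const, card_univ,
        nsmul_eq_mul]
      ring
    rw [h3]
    have := sq_nonneg (Φ none - a)
    have : 0 ≤ (Fintype.card W : ℝ) * a ^ 2 := by positivity
    linarith
  have h4 : ∑ u, ∑ v, c u v * (Φ u - a - (Φ v - a)) ^ 2
      = ∑ u, ∑ v, c (some u) (some v) * (φ u - φ v) ^ 2 + 2 * ∑ u, w u * (φ u - m) ^ 2 := by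
    simp only [Fintype.sum_option, sum_add_distrib, Φ, Option.elim, hsymm (some _) none]
    have : ∀ x y : ℝ, (x - a - (y - a)) ^ 2 = (x - y) ^ 2 := fun x y => by ring
    simp only [this]
    have h5 : ∑ u, c none (some u) * (m - φ u) ^ 2 = ∑ u, w u * (φ u - m) ^ 2 :=
      sum_congr rfl fun u _ => by rw [hw]; ring
    rw [h5]
    simp only [hw]
    ring
  have h6 : ∑ u, ∑ v, w u * w v / s * (φ u - φ v) ^ 2 = 2 * ∑ u, w u * (φ u - m) ^ 2 := by
    have hs0 : 0 ≤ s := sum_nonneg fun u _ => hc _ _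
    rcases hs0.eq_or_lt with h0 | h0
    · have hz : ∀ u, w u = 0 := fun u =>
        (sum_eq_zero_iff_of_nonneg fun u _ => hc none (some u)).1 h0.symm u (mem_univ u)
      simp [hz]
    · have e1 : ∑ u, ∑ v, w u * w v / s * (φ u - φ v) ^ 2
          = (2 * s * ∑ u, w u * φ u ^ 2 - 2 * (∑ u, w u * φ u) ^ 2) / s := by
        have e2 : ∑ u, ∑ v, w u * w v * (φ u - φ v) ^ 2
            = 2 * s * ∑ u, w u * φ u ^ 2 - 2 * (∑ u, w u * φ u) ^ 2 := by
          have e3 : ∀ u v, w u * w v * (φ u - φ v) ^ 2 = (w u * φ u ^ 2) * w v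
              + w u * (w v * φ v ^ 2) - 2 * ((w u * φ u) * (w v * φ v)) := fun u v => by ring
          simp only [e3, sum_sub_distrib, sum_add_distrib, ← mul_sum, ← sum_mul]
          rw [← hs]
          ring
        rw [← e2, sum_div]
        refine sum_congr rfl fun u _ => ?_
        rw [sum_div]
        exact sum_congr rfl fun v _ => by ring
      have e4 : ∑ u, w u * (φ u - m) ^ 2
          = ∑ u, w u * φ u ^ 2 - 2 * m * ∑ u, w u * φ u + s * m ^ 2 := by
        have e5 : ∀ u, w u * (φ u - m) ^ 2 = w u * φ u ^ 2 - 2 * m * (w u * φ u) + w u * m ^ 2 :=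
          fun u => by ring
        simp only [e5, sum_sub_distrib, sum_add_distrib, ← mul_sum, ← sum_mul]
        rw [← hs]
      rw [e1, e4, hm]
      field_simp
      ring
  have h7 : ∑ u, ∑ v, (c (some u) (some v) + w u * w v / s) * (φ u - φ v) ^ 2
      = ∑ u, ∑ v, c (some u) (some v) * (φ u - φ v) ^ 2
        + ∑ u, ∑ v, w u * w v / s * (φ u - φ v) ^ 2 := by
    simp only [add_mul, sum_add_distrib]
  have h8 := mul_le_mul_of_nonneg_left h2 hlam
  rw [h4] at h1
  rw [h7, h6]
  linarith

end Reduction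

end Aldous

/-! ### Induction on the number of vertices -/

section Aldous

open Equiv Finset

/-- The embedding of the permutations of `W` as those of `Option W` that fix `none`. -/
def optionCongrHom (W : Type*) : Perm W →* Perm (Option W) where
  toFun g := g.optionCongr
  map_one' := optionCongr_one
  map_mul' g h := by
    ext x
    cases x <;> simp

theorem optionCongrHom_swap {W : Type*} [DecidableEq W] (x y : W) :
    optionCongrHom W (swap x y) = swap (some x) (some y) :=
  optionCongr_swap x y

theorem sum_perm_fix_none {W : Type*} [Fintype W] [DecidableEq W] (F : Perm (Option W) → ℝ) :
    ∑ g, (if g none = none then F g else 0) = ∑ g, F (optionCongrHom W g) := by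
  rw [← Equiv.sum_comp Perm.decomposeOption.symm, Fintype.sum_prod_type, Fintype.sum_option]
  simp [optionCongrHom]
  rfl

/-- The quadratic form bound for the walk implies that for every permutation representation. -/
def WalkBoundLifts (V : Type*) [Fintype V] [DecidableEq V] : Prop :=
  ∀ (c : V → V → ℝ), (∀ u v, c u v = c v u) → (∀ u v, 0 ≤ c u v) → ∀ lam : ℝ, 0 ≤ lam →
    (∀ φ : V → ℝ, ∑ v, φ v = 0 →
      lam * ∑ v, φ v ^ 2 ≤ (∑ u, ∑ v, c u v * (φ u - φ v) ^ 2) / 2) →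
    ∀ f : Perm V → ℝ, ∑ g, f g = 0 →
      lam * ∑ g, f g ^ 2 ≤ (∑ u, ∑ v, c u v * swapDefect (regularHom V) f u v) / 2

/-- The generator of the interchange process on the group, up to sign. -/
noncomputable def groupGenerator {V : Type*} [Fintype V] [DecidableEq V] (c : V → V → ℝ) :
    (Perm V → ℝ) →ₗ[ℝ] (Perm V → ℝ) where
  toFun f g := (∑ u, ∑ v, c u v * (f g - f (swap u v * g))) / 2
  map_add' f f' := by
    ext g
    simp only [Pi.add_apply, ← add_div, ← sum_add_distrib]
    congr 1
    exact sum_congr rfl fun u _ => sum_congr rfl fun v _ => by ring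
  map_smul' a f := by
    ext g
    simp only [Pi.smul_apply, smul_eq_mul, RingHom.id_apply, mul_div_assoc', mul_sum]
    congr 1
    exact sum_congr rfl fun u _ => sum_congr rfl fun v _ => by ring

theorem groupGenerator_form {V : Type*} [Fintype V] [DecidableEq V] (c : V → V → ℝ)
    (f f' : Perm V → ℝ) :
    ∑ g, f g * groupGenerator c f' g
      = (∑ u, ∑ v, c u v * (∑ g, f g * f' g - ∑ g, f g * f' (swap u v * g))) / 2 := by
  have : ∀ g, f g * groupGenerator c f' g
      = (∑ u, ∑ v, c u v * (f g * f' g - f g * f' (swap u v * g))) / 2 := by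
    intro g
    simp only [groupGenerator, LinearMap.coe_mk, AddHom.coe_mk, mul_div_assoc', mul_sum]
    congr 1
    exact sum_congr rfl fun u _ => sum_congr rfl fun v _ => by ring
  rw [sum_congr rfl fun g _ => this g, ← sum_div]
  congr 1
  rw [sum_comm]
  refine sum_congr rfl fun u _ => ?_
  rw [sum_comm]
  refine sum_congr rfl fun v _ => ?_
  rw [← mul_sum, sum_sub_distrib]

theorem groupGenerator_form_self {V : Type*} [Fintype V] [DecidableEq V] (c : V → V → ℝ)
    (f : Perm V → ℝ) :
    ∑ g, f g * groupGenerator c f g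
      = (∑ u, ∑ v, c u v * swapDefect (regularHom V) f u v) / 2 := by
  rw [groupGenerator_form]
  rfl

theorem groupGenerator_symm {V : Type*} [Fintype V] [DecidableEq V] (c : V → V → ℝ)
    (f f' : Perm V → ℝ) :
    ∑ g, groupGenerator c f g * f' g = ∑ g, f g * groupGenerator c f' g := by
  simp only [mul_comm (groupGenerator c f _)]
  rw [groupGenerator_form, groupGenerator_form]
  congr 1
  refine sum_congr rfl fun u _ => sum_congr rfl fun v _ => ?_
  congr 2
  · exact sum_congr rfl fun g _ => mul_comm _ _
  · rw [← Equiv.sum_comp (Equiv.mulLeft (swap u v))]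
    refine sum_congr rfl fun g _ => ?_
    simp [mul_comm]

/-- Suppose an eigenfunction has μ < lam. Its sums over the orbits of the stabilizer of `none`
vanish, so the induction hypothesis for the reduced rates gives lam ‖f‖² ≤ the reduced form. The
octopus inequality bounds this by the full form, which is μ ‖f‖². -/
theorem walkBoundLifts_option {W : Type*} [Fintype W] [DecidableEq W] (hW : WalkBoundLifts W) :
    WalkBoundLifts (Option W) := by
  intro c hsymm hc lam hlam hRW f hf
  rw [← groupGenerator_form_self]
  rcases hlam.eq_or_lt with h0 | h0
  · rw [← h0, zero_mul, groupGenerator_form_self]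
    refine div_nonneg (sum_nonneg fun u _ => sum_nonneg fun v _ => ?_) two_pos.le
    exact mul_nonneg (hc u v) (swapDefect_nonneg _ _ _ _)
  refine rayleigh_bound_of_eigenvectors (groupGenerator c) (groupGenerator_symm c)
    (by ext g; simp [groupGenerator]) lam h0 ?_ f hf
  intro μ f hne hf hfe
  by_contra! hμ
  have hocc := occupation_sum_eq_zero c lam μ hμ hRW f hf fun g => congrFun hfe g
  have horb : ∀ η : Perm (Option W),
      ∑ g, f ((regularHom (Option W)).comp (optionCongrHom W) g η) = 0 := by
    intro η
    have h1 : ∑ g : Perm (Option W), (if g none = none then f (g * η) else 0) = 0 := by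
      -- The orbit of η consists of the permutations that send η⁻¹ `none` to `none`, so its sum is
      -- an occupation sum.
      refine Eq.trans ?_ (hocc (η⁻¹ none) none)
      rw [← Equiv.sum_comp (Equiv.mulRight η) fun g => if g (η⁻¹ none) = none then f g else 0]
      refine sum_congr rfl fun g _ => ?_
      simp
    rw [sum_perm_fix_none fun g => f (g * η)] at h1
    exact h1
  set c' : W → W → ℝ := fun u v => c (some u) (some v)
      + c none (some u) * c none (some v) / ∑ w, c none (some w) with hc'
  have hred := dirichlet_bound_of_regular c' lam
    (hW c' (fun u v => by simp only [hc', hsymm (some u) (some v), mul_comm (c none (some u))])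
      (fun u v => add_nonneg (hc _ _)
        (div_nonneg (mul_nonneg (hc _ _) (hc _ _)) (sum_nonneg fun _ _ => hc _ _))) lam hlam
      (walk_bound_reduced c hsymm hc lam hlam hRW))
    ((regularHom (Option W)).comp (optionCongrHom W)) f horb
  have hsd : ∀ u v, swapDefect ((regularHom (Option W)).comp (optionCongrHom W)) f u v
      = swapDefect (regularHom (Option W)) f (some u) (some v) := by
    intro u v
    simp only [swapDefect, MonoidHom.comp_apply, optionCongrHom_swap]
  simp only [hsd] at hred
  have hoct := octopus_inequality (regularHom (Option W)) f (fun u => c none (some u))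
    fun u => hc _ _
  have hsplit : ∑ u, ∑ v, c' u v * swapDefect (regularHom (Option W)) f (some u) (some v)
      = ∑ u, ∑ v, c (some u) (some v) * swapDefect (regularHom (Option W)) f (some u) (some v)
      + ∑ u, ∑ v, c none (some u) * c none (some v) / (∑ w, c none (some w))
        * swapDefect (regularHom (Option W)) f (some u) (some v) := by
    simp only [hc', add_mul, sum_add_distrib]
  have hfull : ∑ u, ∑ v, c u v * swapDefect (regularHom (Option W)) f u v
      = ∑ u, ∑ v, c (some u) (some v) * swapDefect (regularHom (Option W)) f (some u) (some v)
      + 2 * ∑ u, c none (some u) * swapDefect (regularHom (Option W)) f none (some u) := by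
    have hs : ∀ u, swapDefect (regularHom (Option W)) f (some u) none
        = swapDefect (regularHom (Option W)) f none (some u) := fun u => by
      rw [swapDefect, swap_comm, ← swapDefect]
    simp only [Fintype.sum_option, sum_add_distrib, swapDefect_self, mul_zero, zero_add,
      hsymm (some _) none, hs]
    ring
  have hform := groupGenerator_form_self c f
  rw [hfe] at hform
  have hmu : ∑ g, f g * (μ • f) g = μ * ∑ g, f g ^ 2 := by
    rw [mul_sum]
    refine sum_congr rfl fun g _ => ?_
    simp only [Pi.smul_apply, smul_eq_mul]
    ring
  rw [hmu, hfull] at hform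
  rw [hsplit] at hred
  have hle : lam * ∑ g, f g ^ 2 ≤ μ * ∑ g, f g ^ 2 := by linarith
  have hpos : 0 < ∑ g, f g ^ 2 := by
    obtain ⟨g, hg⟩ := Function.ne_iff.1 hne
    have hg' : 0 < f g ^ 2 := by
      have : f g ≠ 0 := hg
      positivity
    exact sum_pos' (fun _ _ => sq_nonneg _) ⟨g, mem_univ g, hg'⟩
  exact absurd (le_of_mul_le_mul_right hle hpos) (not_le.2 hμ)

theorem walkBoundLifts_of_equiv {V V' : Type*} [Fintype V] [DecidableEq V] [Fintype V']
    [DecidableEq V'] (e : V ≃ V') (hV : WalkBoundLifts V) : WalkBoundLifts V' := by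
  intro c hsymm hc lam hlam hRW f hf
  have h1 := hV (fun u v => c (e u) (e v)) (fun u v => hsymm _ _) (fun u v => hc _ _) lam hlam
    (fun φ hφ => by
      have := hRW (fun x => φ (e.symm x)) (by rw [← hφ]; exact Equiv.sum_comp e.symm φ)
      rw [Equiv.sum_comp e.symm fun x => φ x ^ 2, ← Equiv.sum_comp e] at this
      simp only [← Equiv.sum_comp e fun v => c _ v * _, symm_apply_apply] at this
      exact this)
    (fun g => f (e.permCongr g)) (by rw [← hf]; exact Equiv.sum_comp e.permCongr f)
  rw [Equiv.sum_comp e.permCongr fun g => f g ^ 2] at h1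
  have h2 : ∀ u v, swapDefect (regularHom V) (fun g => f (e.permCongr g)) u v
      = swapDefect (regularHom V') f (e u) (e v) := by
    intro u v
    have h3 := two_mul_swapDefect (regularHom V) (fun g => f (e.permCongr g)) u v
    have h4 := two_mul_swapDefect (regularHom V') f (e u) (e v)
    have h5 : ∑ ω, (f (e.permCongr (regularHom V (swap u v) ω)) - f (e.permCongr ω)) ^ 2
        = ∑ ω, (f (regularHom V' (swap (e u) (e v)) ω) - f ω) ^ 2 := by
      rw [← Equiv.sum_comp e.permCongr]
      refine sum_congr rfl fun g _ => ?_
      have : e.permCongr (swap u v * g) = swap (e u) (e v) * e.permCongr g := by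
        ext x
        exact (e.injective.swap_apply u v _).symm
      rw [regularHom_apply, regularHom_apply, this]
    linarith
  rw [← Equiv.sum_comp e]
  simp only [← Equiv.sum_comp e fun v => c _ v * _]
  simpa only [h2] using h1

theorem walkBoundLifts (V : Type*) [Fintype V] [DecidableEq V] : WalkBoundLifts V := by
  classical
  have : ∀ [DecidableEq V], WalkBoundLifts V := by
    refine Fintype.induction_empty_option (P := fun V _ => ∀ [DecidableEq V], WalkBoundLifts V)
      ?_ ?_ ?_ V
    · intro α β _ e h _
      classical
      let : Fintype α := Fintype.ofEquiv β e.symm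
      exact walkBoundLifts_of_equiv e h
    · intro _ c _ _ lam _ _ f hf
      have h0 : ∀ g, f g = 0 := by
        intro g
        rw [← hf, Fintype.sum_unique]
        congr 1
        exact Subsingleton.elim _ _
      simp [h0]
    · intro α _ h _
      classical
      have := walkBoundLifts_option (W := α) h
      convert this
  exact this

/-- Aldous' spectral gap conjecture, in quadratic form: lower bounds for the Dirichlet form of the
random walk hold for every process driven by the same transpositions. -/
theorem dirichlet_bound_of_walk {V : Type*} [Fintype V] [DecidableEq V] (c : V → V → ℝ)
    (hsymm : ∀ u v, c u v = c v u) (hc : ∀ u v, 0 ≤ c u v) (lam : ℝ) (hlam : 0 ≤ lam)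
    (hRW : ∀ φ : V → ℝ, ∑ v, φ v = 0 →
      lam * ∑ v, φ v ^ 2 ≤ (∑ u, ∑ v, c u v * (φ u - φ v) ^ 2) / 2)
    {Ω : Type*} [Fintype Ω] (ψ : Perm V →* Perm Ω) (f : Ω → ℝ)
    (hf : ∀ ω, ∑ g, f (ψ g ω) = 0) :
    lam * ∑ ω, f ω ^ 2 ≤ (∑ u, ∑ v, c u v * swapDefect ψ f u v) / 2 :=
  dirichlet_bound_of_regular c lam (walkBoundLifts V c hsymm hc lam hlam hRW) ψ f hf

end Aldous

/-! ### The spectral gap of the random walk on a box -/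

section Path

open Finset

/-- The spectral gap of the walk on a path with `n + 1` vertices. -/
noncomputable def pathGap (n : ℕ) : ℝ := 2 - 2 * Real.cos (Real.pi / (n + 1))

theorem pathGap_pos {n : ℕ} : 0 < pathGap n := by
  have hn : (0 : ℝ) < n + 1 := by positivity
  have h1 : Real.cos (Real.pi / (n + 1)) < 1 := by
    have h2 : Real.pi / (n + 1) ≤ Real.pi := by
      rw [div_le_iff₀ hn]
      have : (0 : ℝ) ≤ n := by positivity
      nlinarith [Real.pi_pos]
    have h3 : 0 < Real.pi / ((n : ℝ) + 1) := div_pos Real.pi_pos hn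
    simpa only [Real.cos_zero] using Real.cos_lt_cos_of_nonneg_of_le_pi le_rfl h2 h3
  unfold pathGap
  linarith

/-- The ground-state substitution on one edge: the difference of the two sides is the square (px -
qy)²/(pq). -/
theorem sq_sub_ge_of_pos {x y p q : ℝ} (hp : 0 < p) (hq : 0 < q) :
    x ^ 2 * (1 - p / q) + y ^ 2 * (1 - q / p) ≤ (x - y) ^ 2 := by
  have h : (x - y) ^ 2 - (x ^ 2 * (1 - p / q) + y ^ 2 * (1 - q / p))
      = (p * x - q * y) ^ 2 / (p * q) := by
    field_simp
    ring
  have : 0 ≤ (p * x - q * y) ^ 2 / (p * q) := by positivity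
  linarith

/-- The discrete Poincaré inequality with Dirichlet boundary conditions. -/
theorem dirichlet_poincare (n : ℕ) (S : ℕ → ℝ) (h0 : S 0 = 0) (hn : S (n + 1) = 0) :
    pathGap n * ∑ k ∈ range (n + 1), S k ^ 2 ≤ ∑ k ∈ range (n + 1), (S (k + 1) - S k) ^ 2 := by
  set t : ℝ := Real.pi / (n + 1) with ht
  have hn1 : (0 : ℝ) < n + 1 := by positivity
  -- The positive Dirichlet ground state. Its zeros at 0 and n + 1 are harmless: S vanishes there,
  -- which kills the terms of g and B that divide by zero.
  let h : ℕ → ℝ := fun k => Real.sin (t * k)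
  have hh0 : h 0 = 0 := by simp [h]
  have hhn : h (n + 1) = 0 := by
    have : t * ((n + 1 : ℕ) : ℝ) = Real.pi := by
      rw [ht]
      push_cast
      field_simp
    simp only [h, this, Real.sin_pi]
  have hpos : ∀ k, 0 < k → k < n + 1 → 0 < h k := by
    intro k hk hk'
    have hk1 : (0 : ℝ) < k := by exact_mod_cast hk
    have hk2 : (k : ℝ) < n + 1 := by exact_mod_cast hk'
    refine Real.sin_pos_of_pos_of_lt_pi (by positivity) ?_
    rw [ht, div_mul_eq_mul_div, div_lt_iff₀ hn1]
    exact mul_lt_mul_of_pos_left hk2 Real.pi_pos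
  have hrec : ∀ k, 0 < k → h (k - 1) + h (k + 1) = (2 - pathGap n) * h k := by
    intro k hk
    have e1 : ((k - 1 : ℕ) : ℝ) = (k : ℝ) - 1 := by
      rw [Nat.cast_sub hk]
      simp
    simp only [h, pathGap, e1, ← ht]
    rw [show t * ((k : ℝ) - 1) = t * k - t by ring,
      show t * ((k + 1 : ℕ) : ℝ) = t * k + t by push_cast; ring, Real.sin_sub, Real.sin_add]
    ring
  let g : ℕ → ℝ := fun k => S k ^ 2 * (1 - h (k - 1) / h k)
  let B : ℕ → ℝ := fun k => S k ^ 2 * (1 - h (k + 1) / h k)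
  have hterm : ∀ k ∈ range (n + 1), g (k + 1) + B k ≤ (S (k + 1) - S k) ^ 2 := by
    intro k hk
    have hk' : k < n + 1 := mem_range.1 hk
    simp only [g, B, Nat.add_sub_cancel]
    rcases Nat.eq_zero_or_pos k with rfl | hk0
    · rw [h0, hh0]
      simp
    · rcases Nat.lt_or_ge (k + 1) (n + 1) with hlt | hge
      · exact sq_sub_ge_of_pos (hpos k hk0 hk') (hpos (k + 1) (by omega) hlt)
      · obtain rfl : k = n := by omega
        rw [hn, hhn]
        simp
  have hshift : ∑ k ∈ range (n + 1), g (k + 1) = ∑ k ∈ range (n + 1), g k := by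
    have h1 := sum_range_succ g (n + 1)
    have h2 := sum_range_succ' g (n + 1)
    have g0 : g 0 = 0 := by simp [g, h0]
    have gn : g (n + 1) = 0 := by simp [g, hn]
    linarith
  have hsum : ∀ k ∈ range (n + 1), g k + B k = pathGap n * S k ^ 2 := by
    intro k hk
    have hk' : k < n + 1 := mem_range.1 hk
    rcases Nat.eq_zero_or_pos k with rfl | hk0
    · simp [g, B, h0]
    · have hp := hpos k hk0 hk'
      have hr : h (k - 1) / h k + h (k + 1) / h k = 2 - pathGap n := by
        rw [← add_div, hrec k hk0]
        field_simp
      simp only [g, B]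
      linear_combination (-S k ^ 2) * hr
  calc pathGap n * ∑ k ∈ range (n + 1), S k ^ 2
      = ∑ k ∈ range (n + 1), (g k + B k) := by rw [sum_congr rfl hsum, mul_sum]
    _ = ∑ k ∈ range (n + 1), (g (k + 1) + B k) := by rw [sum_add_distrib, sum_add_distrib, hshift]
    _ ≤ _ := sum_le_sum hterm

/-- The discrete Poincaré inequality for mean-zero functions on a path. -/
theorem path_poincare (n : ℕ) (φ : ℕ → ℝ) (hφ : ∑ k ∈ range (n + 1), φ k = 0) :
    pathGap n * ∑ k ∈ range (n + 1), φ k ^ 2 ≤ ∑ k ∈ range n, (φ (k + 1) - φ k) ^ 2 := by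
  -- Mean zero means that S vanishes at both ends. Summation by parts and Cauchy–Schwarz bound ‖φ‖⁴
  -- by the energy times ‖S‖², and `dirichlet_poincare` bounds ‖S‖² by ‖φ‖² / `pathGap n`.
  let S : ℕ → ℝ := fun k => ∑ j ∈ range k, φ j
  have hS : ∀ k, S (k + 1) - S k = φ k := fun k => by simp [S, sum_range_succ]
  have h1 := dirichlet_poincare n S (by simp [S]) hφ
  simp only [hS] at h1
  have hparts : ∀ m, ∑ k ∈ range (m + 1), φ k ^ 2
      = φ m * S (m + 1) - ∑ k ∈ range m, (φ (k + 1) - φ k) * S (k + 1) := by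
    intro m
    induction m with
    | zero => simp [S, pow_two]
    | succ m ih =>
      rw [sum_range_succ, ih, sum_range_succ _ m]
      have := hS (m + 1)
      have e : φ (m + 1) ^ 2 = φ (m + 1) * (S (m + 2) - S (m + 1)) := by
        rw [show m + 2 = m + 1 + 1 from rfl, this, pow_two]
      rw [e]
      ring
  have h2 : ∑ k ∈ range (n + 1), φ k ^ 2 = - ∑ k ∈ range n, (φ (k + 1) - φ k) * S (k + 1) := by
    rw [hparts n, show S (n + 1) = 0 from hφ]
    ring
  have h3 : (∑ k ∈ range n, (φ (k + 1) - φ k) * S (k + 1)) ^ 2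
      ≤ (∑ k ∈ range n, (φ (k + 1) - φ k) ^ 2) * ∑ k ∈ range n, S (k + 1) ^ 2 :=
    sum_mul_sq_le_sq_mul_sq _ _ _
  have h4 : ∑ k ∈ range n, S (k + 1) ^ 2 = ∑ k ∈ range (n + 1), S k ^ 2 := by
    rw [sum_range_succ']
    simp [S]
  set X := ∑ k ∈ range (n + 1), φ k ^ 2 with hX
  set D := ∑ k ∈ range n, (φ (k + 1) - φ k) ^ 2 with hD
  have hX0 : 0 ≤ X := sum_nonneg fun _ _ => sq_nonneg _
  have hD0 : 0 ≤ D := sum_nonneg fun _ _ => sq_nonneg _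
  rcases hX0.eq_or_lt with hx | hx
  · rw [← hx]
    simpa using hD0
  · rw [h4] at h3
    have h5 : X ^ 2 ≤ D * ∑ k ∈ range (n + 1), S k ^ 2 := by
      rw [h2, neg_sq]
      exact h3
    have hg : 0 < pathGap n := pathGap_pos
    have h6 : pathGap n * X * X ≤ D * X := by
      calc pathGap n * X * X = pathGap n * X ^ 2 := by ring
        _ ≤ pathGap n * (D * ∑ k ∈ range (n + 1), S k ^ 2) := mul_le_mul_of_nonneg_left h5 hg.le
        _ = D * (pathGap n * ∑ k ∈ range (n + 1), S k ^ 2) := by ring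
        _ ≤ D * X := mul_le_mul_of_nonneg_left h1 hD0
    exact le_of_mul_le_mul_right h6 hx

/-- The jump rates of the walk on a path. -/
def pathRate (n : ℕ) (a b : Fin (n + 1)) : ℝ :=
  if |((a : ℕ) : ℤ) - ((b : ℕ) : ℤ)| = 1 then 1 else 0

theorem pathRate_eq (n : ℕ) (a b : Fin (n + 1)) : pathRate n a b
    = (if (b : ℕ) = a + 1 then 1 else 0) + (if (a : ℕ) = b + 1 then 1 else 0) := by
  have h : |((a : ℕ) : ℤ) - ((b : ℕ) : ℤ)| = 1 ↔ ((b : ℕ) = a + 1 ∨ (a : ℕ) = b + 1) := by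
    rw [abs_eq (by norm_num)]
    omega
  simp only [pathRate, h]
  split_ifs <;> first | (exfalso; omega) | norm_num

end Path

/-! ### Poincaré inequalities on products and boxes -/

section Tensorization

open Finset

/-- The Poincaré inequality `lam ‖φ‖² ≤ ½ ∑ c (φ u - φ v)²` for mean-zero `φ`. -/
def PoincareBound {V : Type*} [Fintype V] (c : V → V → ℝ) (lam : ℝ) : Prop :=
  ∀ φ : V → ℝ, ∑ v, φ v = 0 → lam * ∑ v, φ v ^ 2 ≤ (∑ u, ∑ v, c u v * (φ u - φ v) ^ 2) / 2

theorem poincareBound_path (n : ℕ) : PoincareBound (pathRate n) (pathGap n) := by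
  intro φ hφ
  let F : ℕ → ℝ := fun k => if h : k < n + 1 then φ ⟨k, h⟩ else 0
  have hF : ∀ a : Fin (n + 1), φ a = F a := fun a => by
    simp only [F]
    rw [dif_pos a.2]
  have hone : ∑ a : Fin (n + 1), ∑ b : Fin (n + 1),
      (if (b : ℕ) = a + 1 then (1 : ℝ) else 0) * (φ a - φ b) ^ 2
      = ∑ k ∈ range n, (F (k + 1) - F k) ^ 2 := by
    rw [Fin.sum_univ_castSucc]
    have hlast : ∑ b : Fin (n + 1), (if (b : ℕ) = ((Fin.last n : Fin (n + 1)) : ℕ) + 1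
        then (1 : ℝ) else 0) * (φ (Fin.last n) - φ b) ^ 2 = 0 := by
      refine sum_eq_zero fun b _ => ?_
      have : ¬ (b : ℕ) = ((Fin.last n : Fin (n + 1)) : ℕ) + 1 := by
        have := b.2
        simp only [Fin.val_last]
        omega
      rw [if_neg this, zero_mul]
    rw [hlast, add_zero, ← Fin.sum_univ_eq_sum_range fun k => (F (k + 1) - F k) ^ 2]
    refine sum_congr rfl fun k _ => ?_
    rw [sum_eq_single k.succ]
    · rw [hF, hF]
      simp only [Fin.val_castSucc, Fin.val_succ, if_true]
      ring
    · intro b _ hb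
      have : ¬ (b : ℕ) = ((k.castSucc : Fin (n + 1)) : ℕ) + 1 := by
        intro h
        exact hb (Fin.ext (by simpa using h))
      rw [if_neg this, zero_mul]
    · simp
  have htwo : ∑ a : Fin (n + 1), ∑ b : Fin (n + 1),
      (if (a : ℕ) = b + 1 then (1 : ℝ) else 0) * (φ a - φ b) ^ 2
      = ∑ k ∈ range n, (F (k + 1) - F k) ^ 2 := by
    rw [sum_comm, ← hone]
    refine sum_congr rfl fun a _ => sum_congr rfl fun b _ => ?_
    ring
  have hsum : ∑ a, ∑ b, pathRate n a b * (φ a - φ b) ^ 2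
      = 2 * ∑ k ∈ range n, (F (k + 1) - F k) ^ 2 := by
    simp only [pathRate_eq, add_mul, sum_add_distrib]
    rw [hone, htwo]
    ring
  rw [hsum]
  have h1 : ∑ k ∈ range (n + 1), F k = 0 := by
    rw [← hφ, ← Fin.sum_univ_eq_sum_range]
    exact sum_congr rfl fun a _ => (hF a).symm
  have h2 := path_poincare n F h1
  have h3 : ∑ a, φ a ^ 2 = ∑ k ∈ range (n + 1), F k ^ 2 := by
    rw [← Fin.sum_univ_eq_sum_range fun k => F k ^ 2]
    exact sum_congr rfl fun a _ => by rw [hF]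
  rw [h3]
  linarith

theorem poincareBound_of_equiv {V V' : Type*} [Fintype V] [Fintype V'] (e : V ≃ V')
    {c : V → V → ℝ} {c' : V' → V' → ℝ} (hc : ∀ u v, c' (e u) (e v) = c u v) {lam : ℝ}
    (h : PoincareBound c lam) : PoincareBound c' lam := by
  intro φ hφ
  have h1 := h (fun v => φ (e v)) (by rw [← hφ]; exact Equiv.sum_comp e φ)
  rw [Equiv.sum_comp e fun v => φ v ^ 2] at h1
  rw [← Equiv.sum_comp e fun u => ∑ v, c' u v * (φ u - φ v) ^ 2]
  have h2 : ∀ u, ∑ v, c' (e u) v * (φ (e u) - φ v) ^ 2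
      = ∑ v, c u v * (φ (e u) - φ (e v)) ^ 2 := by
    intro u
    rw [← Equiv.sum_comp e]
    exact sum_congr rfl fun v _ => by rw [hc]
  simpa only [h2] using h1

/-- The variance splits into the variances inside the fibres over B and that of the fibre means m.
The first are controlled by c. For the means, Jensen's inequality bounds the c' energy of m by the
average over A. -/
theorem poincareBound_prod {A B : Type*} [Fintype A] [Fintype B] [DecidableEq A] [DecidableEq B]
    [Nonempty A] {c : A → A → ℝ} {c' : B → B → ℝ} (hc' : ∀ u v, 0 ≤ c' u v) {lam : ℝ}
    (h : PoincareBound c lam) (h' : PoincareBound c' lam) :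
    PoincareBound (fun x y : A × B => (if x.2 = y.2 then c x.1 y.1 else 0)
      + (if x.1 = y.1 then c' x.2 y.2 else 0)) lam := by
  intro φ hφ
  have hN : (0 : ℝ) < Fintype.card A := by exact_mod_cast Fintype.card_pos
  set N : ℝ := (Fintype.card A : ℝ) with hNdef
  let m : B → ℝ := fun b => (∑ a, φ (a, b)) / N
  have hm : ∑ b, m b = 0 := by
    simp only [m]
    rw [← sum_div, sum_comm, ← Fintype.sum_prod_type, hφ, zero_div]
  have hvar : ∑ x, φ x ^ 2 = ∑ b, ∑ a, (φ (a, b) - m b) ^ 2 + N * ∑ b, m b ^ 2 := by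
    rw [Fintype.sum_prod_type, sum_comm, mul_sum, ← sum_add_distrib]
    refine sum_congr rfl fun b _ => ?_
    have e1 : ∀ a, (φ (a, b) - m b) ^ 2 = φ (a, b) ^ 2 - 2 * m b * φ (a, b) + m b ^ 2 :=
      fun a => by ring
    have e2 : ∑ a, φ (a, b) = N * m b := by
      simp only [m]
      field_simp
    simp only [e1, sum_add_distrib, sum_sub_distrib, ← mul_sum, e2, sum_const, card_univ,
      nsmul_eq_mul]
    rw [← hNdef]
    ring
  have hA : ∀ b, lam * ∑ a, (φ (a, b) - m b) ^ 2
      ≤ (∑ a, ∑ a', c a a' * (φ (a, b) - φ (a', b)) ^ 2) / 2 := by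
    intro b
    have := h (fun a => φ (a, b) - m b) (by
      simp only [sum_sub_distrib, sum_const, card_univ, nsmul_eq_mul, m]
      rw [← hNdef]
      field_simp
      ring)
    simpa only [sub_sub_sub_cancel_right] using this
  have hB := h' m hm
  have hjensen : ∀ b b', N * (m b - m b') ^ 2 ≤ ∑ a, (φ (a, b) - φ (a, b')) ^ 2 := by
    intro b b'
    have h1 := sq_sum_le_card_mul_sum_sq (s := (univ : Finset A))
      (f := fun a => φ (a, b) - φ (a, b'))
    have h2 : ∑ a, (φ (a, b) - φ (a, b')) = N * (m b - m b') := by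
      simp only [m, sum_sub_distrib]
      field_simp
    rw [h2, card_univ, ← hNdef] at h1
    have h3 : N * (N * (m b - m b') ^ 2) ≤ N * ∑ a, (φ (a, b) - φ (a, b')) ^ 2 := by
      calc N * (N * (m b - m b') ^ 2) = (N * (m b - m b')) ^ 2 := by ring
        _ ≤ _ := h1
    exact le_of_mul_le_mul_left h3 hN
  have hB' : N * (∑ b, ∑ b', c' b b' * (m b - m b') ^ 2)
      ≤ ∑ b, ∑ b', ∑ a, c' b b' * (φ (a, b) - φ (a, b')) ^ 2 := by
    rw [mul_sum]
    refine sum_le_sum fun b _ => ?_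
    rw [mul_sum]
    refine sum_le_sum fun b' _ => ?_
    rw [← mul_sum]
    have := mul_le_mul_of_nonneg_left (hjensen b b') (hc' b b')
    linarith
  have hform : ∑ x : A × B, ∑ y : A × B, ((if x.2 = y.2 then c x.1 y.1 else 0)
      + (if x.1 = y.1 then c' x.2 y.2 else 0)) * (φ x - φ y) ^ 2
      = ∑ b, ∑ a, ∑ a', c a a' * (φ (a, b) - φ (a', b)) ^ 2
        + ∑ b, ∑ b', ∑ a, c' b b' * (φ (a, b) - φ (a, b')) ^ 2 := by
    simp only [add_mul, sum_add_distrib, Fintype.sum_prod_type, ite_mul, zero_mul]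
    congr 1
    · rw [sum_comm]
      refine sum_congr rfl fun b _ => sum_congr rfl fun a _ => sum_congr rfl fun a' _ => ?_
      simp
    · rw [sum_comm]
      refine sum_congr rfl fun b _ => ?_
      rw [sum_comm]
      have : ∀ a, ∑ a', ∑ b', (if a = a' then c' b b' * (φ (a, b) - φ (a', b')) ^ 2 else 0)
          = ∑ b', c' b b' * (φ (a, b) - φ (a, b')) ^ 2 := by
        intro a
        rw [sum_comm]
        simp
      rw [← sum_comm, sum_congr rfl fun a _ => this a, sum_comm]
  rw [hform, hvar, mul_add]
  have h1 : lam * ∑ b, ∑ a, (φ (a, b) - m b) ^ 2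
      ≤ (∑ b, ∑ a, ∑ a', c a a' * (φ (a, b) - φ (a', b)) ^ 2) / 2 := by
    rw [mul_sum, sum_div]
    exact sum_le_sum fun b _ => hA b
  have h2 := mul_le_mul_of_nonneg_left hB hN.le
  linarith

theorem walkRate_nonneg {V : Type*} (G : SimpleGraph V) (u v : V) : 0 ≤ walkRate G u v := by
  unfold walkRate
  split_ifs <;> simp

theorem walkRate_symm {V : Type*} (G : SimpleGraph V) (u v : V) :
    walkRate G u v = walkRate G v u := by
  unfold walkRate
  by_cases h : G.Adj u v
  · rw [if_pos h, if_pos h.symm]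
  · rw [if_neg h, if_neg fun h' => h h'.symm]

theorem walkRate_box_cons (d n : ℕ) (a b : Fin (n + 1)) (x y : Fin d → Fin (n + 1)) :
    walkRate (boxGraph (d + 1) n) (Fin.cons a x : Fin (d + 1) → Fin (n + 1))
      (Fin.cons b y : Fin (d + 1) → Fin (n + 1))
      = (if x = y then pathRate n a b else 0)
        + (if a = b then walkRate (boxGraph d n) x y else 0) := by
  simp only [walkRate, boxGraph, pathRate, Fin.sum_univ_succ, Fin.cons_zero, Fin.cons_succ]
  have hnonneg : 0 ≤ ∑ i, |((x i : ℕ) : ℤ) - ((y i : ℕ) : ℤ)| :=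
    Finset.sum_nonneg fun _ _ => abs_nonneg _
  have hzero : ∑ i, |((x i : ℕ) : ℤ) - ((y i : ℕ) : ℤ)| = 0 ↔ x = y := by
    rw [Finset.sum_eq_zero_iff_of_nonneg fun _ _ => abs_nonneg _]
    constructor
    · intro h
      funext i
      have := abs_eq_zero.1 (h i (Finset.mem_univ i))
      exact Fin.ext (by omega)
    · rintro rfl
      simp
  by_cases hab : a = b
  · subst hab
    by_cases h : ∑ i, |((x i : ℕ) : ℤ) - ((y i : ℕ) : ℤ)| = 1 <;> simp [h]
  · have hpos : 1 ≤ |((a : ℕ) : ℤ) - ((b : ℕ) : ℤ)| := by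
      refine Int.one_le_abs fun h => hab (Fin.ext (by omega))
    by_cases hxy : x = y
    · subst hxy
      simp [hab]
    · have : ∑ i, |((x i : ℕ) : ℤ) - ((y i : ℕ) : ℤ)| ≠ 0 := fun h => hxy (hzero.1 h)
      rw [if_neg (by omega), if_neg hxy, if_neg hab, add_zero]

theorem poincareBound_box (d n : ℕ) : PoincareBound (walkRate (boxGraph d n)) (pathGap n) := by
  induction d with
  | zero =>
    intro φ hφ
    have h0 : ∀ v, φ v = 0 := by
      intro v
      rw [← hφ, Fintype.sum_unique]
      congr 1
      exact Subsingleton.elim _ _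
    simp [h0]
  | succ d ih =>
    exact poincareBound_of_equiv (Fin.consEquiv fun _ => Fin (n + 1))
      (fun u v => walkRate_box_cons d n u.1 v.1 u.2 v.2)
      (poincareBound_prod (walkRate_nonneg _) (poincareBound_path n) ih)

end Tensorization

/-! ### Spectral gaps of the chains driven by transpositions -/

section Generators

open Equiv Finset

variable {V : Type*} [Fintype V] [DecidableEq V] {Ω : Type*} [Fintype Ω]

theorem rateMatrix_mulVec [DecidableEq Ω] (r : Ω → Ω → ℝ) (f : Ω → ℝ) (x : Ω) :
    (rateMatrix r).mulVec f x = ∑ y, r x y * (f y - f x) := by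
  rw [rateMatrix, Matrix.sub_mulVec, Pi.sub_apply, Matrix.mulVec_diagonal]
  simp only [Matrix.mulVec, dotProduct, Matrix.of_apply, mul_sub, sum_sub_distrib, sum_mul]

/-- The generator of the chain on `Ω` in which every transposition `swap u v` acts at rate
`c u v`; every unordered pair is counted twice. -/
noncomputable def swapGenerator (c : V → V → ℝ) (ψ : Perm V →* Perm Ω) (f : Ω → ℝ) (ω : Ω) : ℝ :=
  (∑ u, ∑ v, c u v * (f (ψ (swap u v) ω) - f ω)) / 2

theorem swapGenerator_id (c : V → V → ℝ) (hsymm : ∀ u v, c u v = c v u) (f : V → ℝ) (x : V) :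
    swapGenerator c (MonoidHom.id (Perm V)) f x = ∑ v, c x v * (f v - f x) := by
  have h : ∀ u v, c u v * (f (swap u v x) - f x)
      = (if x = u then c u v * (f v - f x) else 0)
        + (if x = v then c u v * (f u - f x) else 0) := by
    intro u v
    by_cases h1 : x = u
    · subst h1
      by_cases h2 : x = v
      · subst h2
        simp
      · simp [h2]
    · by_cases h2 : x = v
      · subst h2
        simp [h1]
      · simp [h1, h2, swap_apply_of_ne_of_ne h1 h2]
  have h1 : ∑ u, ∑ v, (if x = u then c u v * (f v - f x) else 0)
      = ∑ v, c x v * (f v - f x) := by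
    rw [sum_comm]
    simp
  have h2 : ∑ u, ∑ v, (if x = v then c u v * (f u - f x) else 0)
      = ∑ v, c x v * (f v - f x) := by
    refine sum_congr rfl fun u _ => ?_
    simp [hsymm x u]
  simp only [swapGenerator, MonoidHom.id_apply, h, sum_add_distrib]
  rw [h1, h2]
  ring

theorem le_of_mem_gapSet (c : V → V → ℝ) (hsymm : ∀ u v, c u v = c v u) (hc : ∀ u v, 0 ≤ c u v)
    {lam : ℝ} (hlam : 0 ≤ lam) (hP : PoincareBound c lam) (ψ : Perm V →* Perm Ω)
    (Q : Matrix Ω Ω ℝ) (hQ : ∀ f ω, Q.mulVec f ω = swapGenerator c ψ f ω)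
    {α : ℝ} (hα : α ∈ gapSet Q) : lam ≤ α := by
  obtain ⟨hα0, f, hne, hf⟩ := hα
  have hgen : ∀ ω, swapGenerator c ψ f ω = -α * f ω := by
    intro ω
    rw [← hQ, hf]
    rfl
  -- Averaging over the group annihilates the generator, so the orbit sums are multiplied by α ≠ 0
  -- and yet give 0. No connectedness of the graph is needed.
  have horb : ∀ ω, ∑ g, f (ψ g ω) = 0 := by
    intro ω
    have h1 : ∑ g, swapGenerator c ψ f (ψ g ω) = 0 := by
      simp only [swapGenerator]
      rw [← sum_div, sum_comm, sum_eq_zero, zero_div]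
      intro u _
      rw [sum_comm]
      refine sum_eq_zero fun v _ => ?_
      rw [← mul_sum, sum_sub_distrib]
      have : ∑ g, f (ψ (swap u v) (ψ g ω)) = ∑ g, f (ψ g ω) := by
        rw [← Equiv.sum_comp (Equiv.mulLeft (swap u v)) fun g => f (ψ g ω)]
        simp
      rw [this, sub_self, mul_zero]
    simp only [hgen, ← mul_sum] at h1
    exact (mul_eq_zero.1 h1).resolve_left (by linarith)
  have hbound := dirichlet_bound_of_walk c hsymm hc lam hlam hP ψ f horb
  have hform : (∑ u, ∑ v, c u v * swapDefect ψ f u v) / 2 = α * ∑ ω, f ω ^ 2 := by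
    have h1 : ∑ ω, f ω * swapGenerator c ψ f ω
        = -((∑ u, ∑ v, c u v * swapDefect ψ f u v) / 2) := by
      have h2 : ∀ ω, f ω * swapGenerator c ψ f ω
          = (∑ u, ∑ v, c u v * (f ω * f (ψ (swap u v) ω) - f ω * f ω)) / 2 := by
        intro ω
        simp only [swapGenerator, mul_div_assoc', mul_sum]
        congr 1
        exact sum_congr rfl fun u _ => sum_congr rfl fun v _ => by ring
      rw [sum_congr rfl fun ω _ => h2 ω, ← sum_div, ← neg_div]
      congr 1
      rw [sum_comm, ← sum_neg_distrib]
      refine sum_congr rfl fun u _ => ?_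
      rw [sum_comm, ← sum_neg_distrib]
      refine sum_congr rfl fun v _ => ?_
      rw [← mul_sum, sum_sub_distrib, swapDefect, autocorr, autocorr]
      simp only [Perm.one_apply]
      ring
    have h3 : ∑ ω, f ω * swapGenerator c ψ f ω = -(α * ∑ ω, f ω ^ 2) := by
      rw [mul_sum, ← sum_neg_distrib]
      refine sum_congr rfl fun ω _ => ?_
      rw [hgen]
      ring
    linarith
  rw [hform] at hbound
  have hpos : 0 < ∑ ω, f ω ^ 2 := by
    obtain ⟨ω, hω⟩ := Function.ne_iff.1 hne
    have hω' : 0 < f ω ^ 2 := by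
      have : f ω ≠ 0 := hω
      positivity
    exact sum_pos' (fun _ _ => sq_nonneg _) ⟨ω, mem_univ ω, hω'⟩
  exact le_of_mul_le_mul_right hbound hpos

/-- The equivariant κ records where a set of particles sits. The generator then acts on the sum of φ
over κ particle by particle, because moving the configuration by a transposition moves each of these
points by it. -/
theorem mem_gapSet_of_walk_eigenfunction (c : V → V → ℝ) {lam : ℝ} (hlam : 0 < lam)
    (φ : V → ℝ) (hφ : ∀ x, swapGenerator c (MonoidHom.id (Perm V)) φ x = -lam * φ x)
    (ψ : Perm V →* Perm Ω) (Q : Matrix Ω Ω ℝ) (hQ : ∀ f ω, Q.mulVec f ω = swapGenerator c ψ f ω)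
    (κ : Ω → Finset V) (hκ : ∀ g ω, κ (ψ g ω) = (κ ω).map g.toEmbedding)
    (hne : ∃ ω, ∑ x ∈ κ ω, φ x ≠ 0) : lam ∈ gapSet Q := by
  refine ⟨hlam, fun ω => ∑ x ∈ κ ω, φ x, ?_, ?_⟩
  · obtain ⟨ω, hω⟩ := hne
    exact fun h => hω (congrFun h ω)
  · funext ω
    rw [hQ]
    have h1 : swapGenerator c ψ (fun ω => ∑ x ∈ κ ω, φ x) ω
        = ∑ x ∈ κ ω, swapGenerator c (MonoidHom.id (Perm V)) φ x := by
      simp only [swapGenerator, hκ, sum_map, MonoidHom.id_apply]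
      symm
      rw [← sum_div, sum_comm]
      congr 1
      refine sum_congr rfl fun u _ => ?_
      rw [sum_comm]
      refine sum_congr rfl fun v _ => ?_
      rw [← mul_sum, sum_sub_distrib]
      rfl
    rw [h1, sum_congr rfl fun x _ => hφ x, ← mul_sum]
    rfl

theorem spectralGap_eq_of_walk (c : V → V → ℝ) (hsymm : ∀ u v, c u v = c v u)
    (hc : ∀ u v, 0 ≤ c u v) {lam : ℝ} (hlam : 0 < lam) (hP : PoincareBound c lam)
    (φ : V → ℝ) (hφ : ∀ x, swapGenerator c (MonoidHom.id (Perm V)) φ x = -lam * φ x)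
    (ψ : Perm V →* Perm Ω) (Q : Matrix Ω Ω ℝ) (hQ : ∀ f ω, Q.mulVec f ω = swapGenerator c ψ f ω)
    (κ : Ω → Finset V) (hκ : ∀ g ω, κ (ψ g ω) = (κ ω).map g.toEmbedding)
    (hne : ∃ ω, ∑ x ∈ κ ω, φ x ≠ 0) : spectralGap Q = lam := by
  have hmem := mem_gapSet_of_walk_eigenfunction c hlam φ hφ ψ Q hQ κ hκ hne
  have hle : ∀ α ∈ gapSet Q, lam ≤ α := fun α hα =>
    le_of_mem_gapSet c hsymm hc hlam.le hP ψ Q hQ hα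
  exact IsLeast.csInf_eq ⟨hmem, hle⟩

/-- A chain that jumps at rate `1` along the transpositions of the edges of a graph, where the
edge of a proper jump is determined by the jump. -/
theorem rateMatrix_mulVec_eq_swapGenerator [DecidableEq Ω] (G : SimpleGraph V) (ψ : Perm V →* Perm Ω)
    (r : Ω → Ω → ℝ)
    (hr1 : ∀ ω u v, G.Adj u v → ψ (swap u v) ω ≠ ω → r ω (ψ (swap u v) ω) = 1)
    (hr0 : ∀ ω ξ, ξ ≠ ω → (∀ u v, G.Adj u v → ξ ≠ ψ (swap u v) ω) → r ω ξ = 0)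
    (huniq : ∀ ω u v u' v', ψ (swap u v) ω ≠ ω → ψ (swap u v) ω = ψ (swap u' v') ω →
      (u' = u ∧ v' = v) ∨ (u' = v ∧ v' = u))
    (f : Ω → ℝ) (ω : Ω) :
    (rateMatrix r).mulVec f ω = swapGenerator (walkRate G) ψ f ω := by
  rw [rateMatrix_mulVec, swapGenerator]
  have h1 : ∀ u v, walkRate G u v * (f (ψ (swap u v) ω) - f ω)
      = ∑ ξ, (if ξ = ψ (swap u v) ω then walkRate G u v * (f ξ - f ω) else 0) := by
    intro u v
    simp
  have h2 : ∑ u, ∑ v, walkRate G u v * (f (ψ (swap u v) ω) - f ω)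
      = ∑ ξ, ∑ u, ∑ v, (if ξ = ψ (swap u v) ω then walkRate G u v * (f ξ - f ω) else 0) := by
    simp only [h1]
    symm
    rw [sum_comm]
    refine sum_congr rfl fun u _ => ?_
    rw [sum_comm]
  rw [h2, sum_div]
  refine sum_congr rfl fun ξ _ => ?_
  by_cases hξ : ξ = ω
  · rw [hξ]
    simp
  by_cases hex : ∃ u v, G.Adj u v ∧ ξ = ψ (swap u v) ω
  · obtain ⟨u, v, hadj, rfl⟩ := hex
    rw [hr1 ω u v hadj hξ, ← Fintype.sum_prod_type'
      (f := fun u' v' => if ψ (swap u v) ω = ψ (swap u' v') ω then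
        walkRate G u' v' * (f (ψ (swap u v) ω) - f ω) else 0)]
    rw [← sum_subset (subset_univ {(u, v), (v, u)})]
    · rw [sum_pair (by
        intro h
        exact hadj.ne (congrArg Prod.fst h))]
      simp only [swap_comm v u, if_true, walkRate, if_pos hadj, if_pos hadj.symm]
      ring
    · rintro ⟨u', v'⟩ _ hnot
      refine if_neg fun h => hnot ?_
      rcases huniq ω u v u' v' hξ h with ⟨rfl, rfl⟩ | ⟨rfl, rfl⟩ <;> simp
  · push Not at hex
    rw [hr0 ω ξ hξ fun u v h => hex u v h]
    symm
    rw [zero_mul, sum_eq_zero, zero_div]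
    intro u _
    refine sum_eq_zero fun v _ => ?_
    by_cases hadj : G.Adj u v
    · rw [if_neg (hex u v hadj)]
    · rw [walkRate, if_neg hadj]
      simp

end Generators

/-! ### Interchange and exclusion as permutation actions -/

section Processes

open Equiv Finset

variable {V : Type*} [DecidableEq V]

theorem swap_eq_swap_cases {u v u' v' : V} (huv : u ≠ v) (h : swap u v = swap u' v') :
    (u' = u ∧ v' = v) ∨ (u' = v ∧ v' = u) := by
  have h1 := congrArg (fun g : Perm V => g u) h
  simp only [swap_apply_left] at h1
  have h2 : u = u' ∨ u = v' := by
    by_contra! hc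
    rw [swap_apply_of_ne_of_ne hc.1 hc.2] at h1
    exact huv h1.symm
  rcases h2 with rfl | rfl
  · left
    rw [swap_apply_left] at h1
    exact ⟨rfl, h1.symm⟩
  · right
    rw [swap_apply_right] at h1
    exact ⟨h1.symm, rfl⟩

/-- Permutations of the vertices act on configurations of labelled particles. -/
def configurationHom (V : Type*) [Fintype V] : Perm V →* Perm (Configuration V) where
  toFun g :=
    { toFun := fun η => η.trans g
      invFun := fun η => η.trans g.symm
      left_inv := fun η => by ext; simp
      right_inv := fun η => by ext; simp }
  map_one' := rfl
  map_mul' g h := rfl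

theorem configurationHom_apply {V : Type*} [Fintype V] (g : Perm V) (η : Configuration V) :
    configurationHom V g η = η.trans g := rfl

theorem interchange_mulVec [Fintype V] (G : SimpleGraph V) (f : Configuration V → ℝ) (η : Configuration V) :
    (rateMatrix (interchangeRate G)).mulVec f η
      = swapGenerator (walkRate G) (configurationHom V) f η := by
  refine rateMatrix_mulVec_eq_swapGenerator G _ _ ?_ ?_ ?_ f η
  · intro ω u v hadj _
    exact if_pos ⟨u, v, hadj, rfl⟩
  · intro ω ξ _ h
    refine if_neg ?_
    rintro ⟨u, v, hadj, hξ⟩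
    exact h u v hadj hξ
  · intro ω u v u' v' hne h
    have huv : u ≠ v := by
      rintro rfl
      exact hne (by rw [configurationHom_apply, swap_self]; rfl)
    refine swap_eq_swap_cases huv ?_
    ext x
    have := congrArg (fun η : Configuration V => η (ω.symm x)) h
    simpa [configurationHom_apply] using this

/-- Permutations of the vertices act on the sets of `m` vertices. -/
def exclusionHom (V : Type*) (m : ℕ) : Perm V →* Perm {s : Finset V // s.card = m} where
  toFun g :=
    { toFun := fun s => ⟨s.1.map g.toEmbedding, by rw [card_map, s.2]⟩
      invFun := fun s => ⟨s.1.map g.symm.toEmbedding, by rw [card_map, s.2]⟩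
      left_inv := fun s => by ext; simp
      right_inv := fun s => by ext; simp }
  map_one' := by
    ext s x
    simp
    rfl
  map_mul' g h := by
    ext s x
    simp
    rfl

theorem mem_exclusionHom {m : ℕ} (u v x : V) (s : {s : Finset V // s.card = m}) :
    x ∈ (exclusionHom V m (swap u v) s).1 ↔ swap u v x ∈ s.1 := by
  change x ∈ s.1.map (swap u v).toEmbedding ↔ _
  rw [mem_map_equiv, symm_swap]

theorem exclusionHom_swap_eq {m : ℕ} {u v : V} (s : {s : Finset V // s.card = m})
    (hu : u ∈ s.1) (hv : v ∉ s.1) :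
    (exclusionHom V m (swap u v) s).1 = insert v (s.1.erase u) := by
  ext x
  rw [mem_exclusionHom, mem_insert, mem_erase]
  by_cases h1 : x = u
  · subst h1
    have : x ≠ v := fun h => hv (h ▸ hu)
    simp [hv, this]
  · by_cases h2 : x = v
    · subst h2
      simp [hu]
    · simp [swap_apply_of_ne_of_ne h1 h2, h1, h2]

theorem exclusionHom_ne {m : ℕ} {u v : V} {s : {s : Finset V // s.card = m}}
    (h : exclusionHom V m (swap u v) s ≠ s) :
    (u ∈ s.1 ∧ v ∉ s.1) ∨ (v ∈ s.1 ∧ u ∉ s.1) := by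
  by_contra hc
  refine h (Subtype.ext ?_)
  ext x
  rw [mem_exclusionHom]
  by_cases h1 : x = u
  · subst h1
    rw [swap_apply_left]
    tauto
  · by_cases h2 : x = v
    · subst h2
      rw [swap_apply_right]
      tauto
    · rw [swap_apply_of_ne_of_ne h1 h2]

theorem exclusion_mulVec [Fintype V] (G : SimpleGraph V) (m : ℕ) (f : {s : Finset V // s.card = m} → ℝ)
    (s : {s : Finset V // s.card = m}) :
    (rateMatrix (exclusionRate G m)).mulVec f s
      = swapGenerator (walkRate G) (exclusionHom V m) f s := by
  refine rateMatrix_mulVec_eq_swapGenerator G _ _ ?_ ?_ ?_ f s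
  · intro s u v hadj hne
    rcases exclusionHom_ne hne with ⟨hu, hv⟩ | ⟨hv, hu⟩
    · exact if_pos ⟨u, v, hadj, hu, hv, exclusionHom_swap_eq s hu hv⟩
    · refine if_pos ⟨v, u, hadj.symm, hv, hu, ?_⟩
      rw [swap_comm]
      exact exclusionHom_swap_eq s hv hu
  · intro s t _ h
    refine if_neg ?_
    rintro ⟨u, v, hadj, hu, hv, ht⟩
    exact h u v hadj (Subtype.ext (by rw [ht, exclusionHom_swap_eq s hu hv]))
  · have key : ∀ (s : {s : Finset V // s.card = m}) (u v u' v' : V), u ∈ s.1 → v ∉ s.1 →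
        exclusionHom V m (swap u v) s = exclusionHom V m (swap u' v') s →
        (u' = u ∧ v' = v) ∨ (u' = v ∧ v' = u) := by
      intro s u v u' v' hu hv h
      have hne : u ≠ v := fun h => hv (h ▸ hu)
      have h1 : swap u' v' u ∉ s.1 := by
        rw [← mem_exclusionHom, ← h, mem_exclusionHom, swap_apply_left]
        exact hv
      have h2 : swap u' v' v ∈ s.1 := by
        rw [← mem_exclusionHom, ← h, mem_exclusionHom, swap_apply_right]
        exact hu
      have h3 : u = u' ∨ u = v' := by
        by_contra! hc
        rw [swap_apply_of_ne_of_ne hc.1 hc.2] at h1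
        exact h1 hu
      have h4 : v = u' ∨ v = v' := by
        by_contra! hc
        rw [swap_apply_of_ne_of_ne hc.1 hc.2] at h2
        exact hv h2
      rcases h3 with rfl | rfl
      · left
        exact ⟨rfl, (h4.resolve_left hne.symm).symm⟩
      · right
        exact ⟨(h4.resolve_right hne.symm).symm, rfl⟩
    intro s u v u' v' hne h
    rcases exclusionHom_ne hne with ⟨hu, hv⟩ | ⟨hv, hu⟩
    · exact key s u v u' v' hu hv h
    · rw [swap_comm u v] at h
      exact (key s v u u' v' hv hu h).symm

end Processes

/-! ### The cosine mode, the exact gaps and their asymptotics -/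

section Box

open Equiv Finset

/-- The cosine profile of the slowest mode of the walk on a path. -/
noncomputable def pathMode (n : ℕ) (x : ℝ) : ℝ := Real.cos (Real.pi / (n + 1) * (x + 1 / 2))

theorem pathMode_rec (n : ℕ) (x : ℝ) :
    pathMode n (x + 1) + pathMode n (x - 1) = (2 - pathGap n) * pathMode n x := by
  set t := Real.pi / (n + 1) with ht
  simp only [pathMode, pathGap, ← ht]
  rw [show t * (x + 1 + 1 / 2) = t * (x + 1 / 2) + t by ring,
    show t * (x - 1 + 1 / 2) = t * (x + 1 / 2) - t by ring, Real.cos_add, Real.cos_sub]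
  ring

theorem pathMode_reflect_left (n : ℕ) : pathMode n (0 - 1) = pathMode n 0 := by
  rw [pathMode, pathMode, ← Real.cos_neg]
  congr 1
  ring

theorem pathMode_reflect_right (n : ℕ) : pathMode n (n + 1) = pathMode n n := by
  have hn : (n : ℝ) + 1 ≠ 0 := by positivity
  rw [pathMode, pathMode, ← Real.cos_two_pi_sub]
  congr 1
  field_simp
  ring

/-- The half-integer shift makes the cosine symmetric about both ends, so the missing neighbours -1
and n + 1 may be added at no cost and the three-term recurrence holds at every vertex. -/
theorem pathMode_eigen (n : ℕ) (a : Fin (n + 1)) :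
    ∑ b : Fin (n + 1), pathRate n a b * (pathMode n (b : ℕ) - pathMode n (a : ℕ))
      = -pathGap n * pathMode n (a : ℕ) := by
  simp only [pathRate_eq, add_mul, sum_add_distrib]
  have h1 : ∑ b : Fin (n + 1), (if (b : ℕ) = a + 1 then (1 : ℝ) else 0)
      * (pathMode n (b : ℕ) - pathMode n (a : ℕ))
      = pathMode n ((a : ℕ) + 1) - pathMode n (a : ℕ) := by
    by_cases ha : (a : ℕ) + 1 < n + 1
    · rw [sum_eq_single ⟨a + 1, ha⟩]
      · simp
      · intro b _ hb
        rw [if_neg fun h => hb (Fin.ext h), zero_mul]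
      · simp
    · have han : (a : ℕ) = n := by
        have := a.2
        omega
      rw [sum_eq_zero, han, pathMode_reflect_right, sub_self]
      intro b _
      have := b.2
      rw [if_neg (by omega), zero_mul]
  have h2 : ∑ b : Fin (n + 1), (if (a : ℕ) = b + 1 then (1 : ℝ) else 0)
      * (pathMode n (b : ℕ) - pathMode n (a : ℕ))
      = pathMode n ((a : ℕ) - 1) - pathMode n (a : ℕ) := by
    rcases Nat.eq_zero_or_pos (a : ℕ) with ha | ha
    · rw [sum_eq_zero, ha, Nat.cast_zero, pathMode_reflect_left, sub_self]
      intro b _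
      rw [if_neg (by omega), zero_mul]
    · have hlt : (a : ℕ) - 1 < n + 1 := by
        have := a.2
        omega
      rw [sum_eq_single ⟨(a : ℕ) - 1, hlt⟩]
      · rw [if_pos (by simp only; omega), one_mul]
        simp only [Nat.cast_sub (show 1 ≤ (a : ℕ) from ha), Nat.cast_one]
      · intro b _ hb
        rw [if_neg, zero_mul]
        intro h
        exact hb (Fin.ext (by simp only; omega))
      · simp
  rw [h1, h2]
  have := pathMode_rec n (a : ℕ)
  linarith

theorem boxMode_eigen (d n : ℕ) (x : Fin (d + 1) → Fin (n + 1)) :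
    swapGenerator (walkRate (boxGraph (d + 1) n)) (MonoidHom.id (Perm _))
      (fun y => pathMode n (y 0 : ℕ)) x = -pathGap n * pathMode n (x 0 : ℕ) := by
  rw [swapGenerator_id _ (walkRate_symm _), ← Equiv.sum_comp (Fin.consEquiv fun _ => Fin (n + 1))]
  obtain ⟨⟨a, x'⟩, rfl⟩ := (Fin.consEquiv fun _ => Fin (n + 1)).surjective x
  change ∑ p : Fin (n + 1) × (Fin d → Fin (n + 1)),
    walkRate (boxGraph (d + 1) n) (Fin.cons a x' : Fin (d + 1) → Fin (n + 1))
      (Fin.cons p.1 p.2 : Fin (d + 1) → Fin (n + 1)) * (pathMode n (p.1 : ℕ) - pathMode n (a : ℕ))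
    = -pathGap n * pathMode n (a : ℕ)
  simp only [walkRate_box_cons]
  rw [← pathMode_eigen, Fintype.sum_prod_type]
  refine sum_congr rfl fun b _ => ?_
  simp only [add_mul, sum_add_distrib, ite_mul, zero_mul, sum_ite_eq, mem_univ, if_true]
  rw [add_eq_left]
  refine sum_eq_zero fun y _ => ?_
  split_ifs with h
  · rw [h, sub_self, mul_zero]
  · rfl

theorem exists_boxMode_ne (d n : ℕ) (hn : 1 ≤ n) : ∃ u v : Fin (d + 1) → Fin (n + 1),
    pathMode n (u 0 : ℕ) ≠ 0 ∧ pathMode n (u 0 : ℕ) ≠ pathMode n (v 0 : ℕ) := by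
  have hn0 : (0 : ℝ) < n + 1 := by positivity
  have hn1 : (1 : ℝ) ≤ n := by exact_mod_cast hn
  have hpos : 0 < pathMode n 0 := by
    have h1 : 0 < Real.pi / (n + 1) * (0 + 1 / 2) := by
      have := Real.pi_pos
      positivity
    have h2 : Real.pi / (n + 1) * (0 + 1 / 2) < Real.pi / 2 := by
      rw [div_mul_eq_mul_div, div_lt_iff₀ hn0]
      nlinarith [Real.pi_pos]
    exact Real.cos_pos_of_mem_Ioo ⟨by linarith, h2⟩
  have hneg : pathMode n n = -pathMode n 0 := by
    rw [pathMode, pathMode, ← Real.cos_pi_sub]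
    congr 1
    field_simp
    ring
  refine ⟨fun _ => 0, fun _ => Fin.last n, ?_, ?_⟩
  · simpa using hpos.ne'
  · simp only [Fin.val_zero, Nat.cast_zero, Fin.val_last, hneg]
    linarith

theorem gapRW_box (d n : ℕ) (hn : 1 ≤ n) : gapRW (boxGraph (d + 1) n) = pathGap n := by
  obtain ⟨u, v, hu, -⟩ := exists_boxMode_ne d n hn
  refine spectralGap_eq_of_walk (walkRate (boxGraph (d + 1) n)) (walkRate_symm _)
    (walkRate_nonneg _) pathGap_pos (poincareBound_box _ _) _ (boxMode_eigen d n)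
    (MonoidHom.id _) _ ?_ (fun x => {x}) (fun g x => by simp) ⟨u, by simpa using hu⟩
  intro f x
  rw [swapGenerator_id _ (walkRate_symm _), rateMatrix_mulVec]

theorem gapIP_box (d n : ℕ) (hn : 1 ≤ n) : gapIP (boxGraph (d + 1) n) = pathGap n := by
  obtain ⟨u, v, hu, -⟩ := exists_boxMode_ne d n hn
  let e : Configuration (Fin (d + 1) → Fin (n + 1)) := (Fintype.equivFin _).symm
  refine spectralGap_eq_of_walk (walkRate (boxGraph (d + 1) n)) (walkRate_symm _)
    (walkRate_nonneg _) pathGap_pos (poincareBound_box _ _) _ (boxMode_eigen d n)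
    (configurationHom _) _ (interchange_mulVec _) (fun η => {η (e.symm u)}) (fun g η => ?_)
    ⟨e, by simpa using hu⟩
  simp [configurationHom_apply]

/-- Replacing u by v in a set that contains u but not v changes the sum by φ v - φ u ≠ 0, so the two
sums cannot both vanish. -/
theorem exists_exclusion_sum_ne_zero {V : Type*} [Fintype V] [DecidableEq V] (φ : V → ℝ) {u v : V}
    (huv : φ u ≠ φ v) {m : ℕ} (hm : 1 ≤ m) (hm' : m < Fintype.card V) :
    ∃ s : {s : Finset V // s.card = m}, ∑ x ∈ s.1, φ x ≠ 0 := by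
  have hne : u ≠ v := fun h => huv (congrArg φ h)
  obtain ⟨s, hs1, hs2, hs3⟩ := exists_subsuperset_card_eq (s := {u}) (t := univ.erase v) (n := m)
    (by simpa using hne) (by simpa using hm) (by
      rw [card_erase_of_mem (mem_univ v), card_univ]
      omega)
  have hu : u ∈ s := hs1 (mem_singleton_self u)
  have hv : v ∉ s := fun h => by simpa using hs2 h
  by_contra! hzero
  have h1 := hzero ⟨s, hs3⟩
  have h2 := hzero (exclusionHom V m (swap u v) ⟨s, hs3⟩)
  rw [exclusionHom_swap_eq ⟨s, hs3⟩ hu hv, sum_insert (by simp [hv])] at h2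
  have h3 := add_sum_erase s φ hu
  simp only at h1 h2
  exact huv (by linarith)

theorem gapSEP_box (d n m : ℕ) (hn : 1 ≤ n) (hm : 1 ≤ m) (hm' : m < (n + 1) ^ (d + 1)) :
    gapSEP (boxGraph (d + 1) n) m = pathGap n := by
  obtain ⟨u, v, -, huv⟩ := exists_boxMode_ne d n hn
  exact spectralGap_eq_of_walk (walkRate (boxGraph (d + 1) n)) (walkRate_symm _)
    (walkRate_nonneg _) pathGap_pos (poincareBound_box _ _) _ (boxMode_eigen d n)
    (exclusionHom _ m) _ (exclusion_mulVec _ m) (fun s => s.1) (fun g s => rfl)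
    (exists_exclusion_sum_ne_zero (fun y : Fin (d + 1) → Fin (n + 1) => pathMode n (y 0 : ℕ))
      huv hm (by simpa using hm'))

/-- By the half-angle formula, the quotient is sinc²(π/(2(L+1))) · (L/(L+1))². -/
theorem pathGap_isEquivalent :
    pathGap ~[Filter.atTop] (fun L : ℕ => Real.pi ^ 2 / (L : ℝ) ^ 2) := by
  refine Asymptotics.isEquivalent_of_tendsto_one ?_
  have hlim : Filter.Tendsto (fun L : ℕ =>
      Real.sinc (Real.pi / 2 / ((L : ℝ) + 1)) ^ 2 * ((L : ℝ) / (L + 1)) ^ 2) Filter.atTop (𝓝 1) := by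
    have h1 : Filter.Tendsto (fun L : ℕ => Real.pi / 2 / ((L : ℝ) + 1)) Filter.atTop (𝓝 0) :=
      Filter.Tendsto.const_div_atTop
        (Filter.tendsto_atTop_add_const_right _ _ tendsto_natCast_atTop_atTop) _
    have h2 := (Real.continuous_sinc.tendsto 0).comp h1
    rw [Real.sinc_zero] at h2
    have h3 := tendsto_natCast_div_add_atTop (1 : ℝ)
    simpa using (h2.pow 2).mul (h3.pow 2)
  refine hlim.congr' ?_
  filter_upwards [Filter.eventually_ge_atTop 1] with L hL
  have hL0 : (0 : ℝ) < L := by exact_mod_cast hL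
  have hpi := Real.pi_pos
  have hgap : pathGap L = 4 * Real.sin (Real.pi / 2 / ((L : ℝ) + 1)) ^ 2 := by
    rw [pathGap, show Real.pi / ((L : ℝ) + 1) = 2 * (Real.pi / 2 / ((L : ℝ) + 1)) by ring,
      Real.cos_two_mul, Real.sin_sq]
    ring
  rw [Pi.div_apply, hgap, Real.sinc_of_ne_zero (by positivity)]
  field_simp
  ring

end Box

theorem mainTheorem1 (d : ℕ) (hd : 1 ≤ d) :
    (fun L : ℕ => gapIP (boxGraph d L)) ~[Filter.atTop]
        (fun L : ℕ => Real.pi ^ 2 / (L : ℝ) ^ 2) ∧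
      Filter.Tendsto (fun L : ℕ => gapIP (boxGraph d L) / gapRW (boxGraph d L))
        Filter.atTop (𝓝 1) ∧
      ∀ m : ℕ → ℕ, (∀ᶠ L in Filter.atTop, 1 ≤ m L ∧ m L < (L + 1) ^ d) →
        (fun L : ℕ => gapSEP (boxGraph d L) (m L)) ~[Filter.atTop]
          (fun L : ℕ => Real.pi ^ 2 / (L : ℝ) ^ 2) := by
  -- Positive dimension supplies the coordinate that carries the cosine; L ≥ 1 below excludes the
  -- one-vertex box.
  obtain ⟨d, rfl⟩ : ∃ d', d = d' + 1 := ⟨d - 1, by omega⟩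
  refine ⟨?_, ?_, ?_⟩
  · refine pathGap_isEquivalent.congr_left ?_
    filter_upwards [Filter.eventually_ge_atTop 1] with L hL
    exact (gapIP_box d L hL).symm
  · refine tendsto_const_nhds.congr' ?_
    filter_upwards [Filter.eventually_ge_atTop 1] with L hL
    rw [gapIP_box d L hL, gapRW_box d L hL, div_self pathGap_pos.ne']
  · intro m hm
    refine pathGap_isEquivalent.congr_left ?_
    filter_upwards [Filter.eventually_ge_atTop 1, hm] with L hL hmL
    exact (gapSEP_box d L (m L) hL hmL.1 hmL.2).symm
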